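/- For integers $1\le \ell<k\le q$ and $e\ge 1$, an $\ell$-$(q,k)$-system with $e$ cliques is a finite $k$-uniform hypergraph for which there are $e$ distinct $q$-element sets of vertices, any two of which share at most $\ell$ vertices, such that the edges are exactly the $k$-element subsets of these $q$-sets. Let $f_\ell(e,q,k)$ be the maximum chromatic number of such a hypergraph, where the chromatic number is the least number of colors in a coloring of the vertices with no monochromatic edge. Theorem. Fix an integer $k\ge 3$. (1) There is a constant $C$, depending only on $k$, such that for all integers $q\ge k$ and $e\ge 1$, $$f_1(e,q,k) < C\, e^{\frac{1}{2k-2}}\, q .$$ (2) For $e>q^{2k+2}$, up to factors polylogarithmic in $e$, $f_1(e,q,k)$ is at least $e^{\frac1{2k-2}}q^{1-\frac2{k-1}}$: there are constants $c>0$ and $a$, depending only on $k$, such that for all integers $q\ge k$ and $e>q^{2k+2}$, $$f_1(e,q,k) > \frac{c\, e^{\frac{1}{2k-2}}\, q^{1-\frac{2}{k-1}}}{(\log e)^{a}} .$$ In particular, whenever $\log e= q^{o(1)}$ (for example when $e$ is polynomial in $q$), $$f_1(e,q,k) > e^{\frac{1}{2k-2}}\, q^{1-\frac{2}{k-1}+o(1)}\qquad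 (q\to\infty).$$ More precisely: if $M:\mathbb N\to\mathbb R$ is such that for every $\delta>0$ we have $\log M(q)\le q^{\delta}$ for all sufficiently large $q$, then there is a function $o:\mathbb N\to\mathbb R$ with $o(q)\to 0$ as $q\to\infty$ such that $f_1(e,q,k) > e^{\frac{1}{2k-2}}q^{1-\frac{2}{k-1}+o(q)}$ for all integers $q\ge k$ and $e$ with $q^{2k+2}<e\le M(q)$. -/

import Mathlib

/-- `H` has a proper colouring with `r` colours: the vertices of `H` can be coloured with the
colours `0, …, r - 1` so that no edge of `H` is monochromatic. -/
def HasProperColoring {V : Type*} (H : Hypergraph V) (r : ℕ) : Prop :=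
  ∃ c : V → ℕ, (∀ x ∈ H.vertexSet, c x < r) ∧
    ∀ A ∈ H.edgeSet, ∃ x ∈ A, ∃ y ∈ A, c x ≠ c y

/-- The chromatic number of a hypergraph (used for hypergraphs with finitely many vertices all of
whose edges have at least two vertices; these always have a proper colouring). -/
noncomputable def chromaticNum {V : Type*} (H : Hypergraph V) : ℕ :=
  sInf {r : ℕ | HasProperColoring H r}

/-- `H` is an `ℓ`-`(q,k)`-system given by the set `𝒬` of cliques: `H` is a finite hypergraph, each
member of `𝒬` is a set of `q` vertices, any two different members of `𝒬` share at most `ℓ`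
vertices, and the edges of `H` are exactly the `k`-element subsets of the members of `𝒬`. -/
structure IsCliqueSystem {V : Type*} (ℓ q k : ℕ) (H : Hypergraph V) (𝒬 : Set (Set V)) : Prop where
  finite_vertexSet : H.vertexSet.Finite
  subset_vertexSet : ∀ Q ∈ 𝒬, Q ⊆ H.vertexSet
  ncard_clique : ∀ Q ∈ 𝒬, Q.ncard = q
  ncard_inter_le : ∀ Q ∈ 𝒬, ∀ Q' ∈ 𝒬, Q ≠ Q' → (Q ∩ Q').ncard ≤ ℓ
  edgeSet_eq : H.edgeSet = {A : Set V | A.ncard = k ∧ ∃ Q ∈ 𝒬, A ⊆ Q}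

/-- The chromatic numbers of the `ℓ`-`(q,k)`-systems with exactly `e` cliques. -/
def systemChromaticNumbers (ℓ e q k : ℕ) : Set ℕ :=
  {χ : ℕ | ∃ (V : Type) (H : Hypergraph V) (𝒬 : Set (Set V)),
    IsCliqueSystem ℓ q k H 𝒬 ∧ 𝒬.ncard = e ∧ chromaticNum H = χ}

/-- `cliqueF ℓ e q k` is `f_ℓ(e,q,k)`, the maximum chromatic number of an `ℓ`-`(q,k)`-system
with `e` cliques. -/
noncomputable def cliqueF (ℓ e q k : ℕ) : ℕ :=
  sSup (systemChromaticNumbers ℓ e q k)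

/-- A system with `e` cliques on `q` vertices has a proper colouring with `e * q + 1` colours. -/
theorem IsCliqueSystem.hasProperColoring {V : Type*} {ℓ q k : ℕ} {H : Hypergraph V}
    {𝒬 : Set (Set V)} (h : IsCliqueSystem ℓ q k H 𝒬) (hk : 2 ≤ k) :
    HasProperColoring H (𝒬.ncard * q + 1) := by
  classical
  have hfin : 𝒬.Finite :=
    h.finite_vertexSet.finite_subsets.subset fun Q hQ => h.subset_vertexSet Q hQ
  have hUfin : (⋃₀ 𝒬).Finite :=
    h.finite_vertexSet.subset (Set.sUnion_subset h.subset_vertexSet)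
  have hcard : hUfin.toFinset.card ≤ 𝒬.ncard * q := by
    have hQf : ∀ Q ∈ 𝒬, Q.Finite := fun Q hQ => h.finite_vertexSet.subset (h.subset_vertexSet Q hQ)
    have hsub : hUfin.toFinset ⊆ hfin.toFinset.biUnion
        (fun Q => if hQ : Q.Finite then hQ.toFinset else ∅) := by
      intro x hx
      obtain ⟨Q, hQ, hxQ⟩ := (Set.Finite.mem_toFinset hUfin).1 hx
      refine Finset.mem_biUnion.2 ⟨Q, (Set.Finite.mem_toFinset hfin).2 hQ, ?_⟩
      simp [hQf Q hQ, hxQ]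
    refine (Finset.card_le_card hsub).trans ?_
    rw [Set.ncard_eq_toFinset_card _ hfin]
    refine Finset.card_biUnion_le_card_mul _ _ _ fun Q hQ => ?_
    have hQ' := (Set.Finite.mem_toFinset hfin).1 hQ
    simp only [hQf Q hQ', dif_pos]
    rw [← Set.ncard_eq_toFinset_card _ (hQf Q hQ'), h.ncard_clique Q hQ']
  let g := hUfin.toFinset.equivFin
  refine ⟨fun x => if hx : x ∈ hUfin.toFinset then (g ⟨x, hx⟩ : ℕ) else 0, ?_, ?_⟩
  · intro x _
    by_cases hx : x ∈ hUfin.toFinset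
    · simp only [hx, dif_pos]
      have := (g ⟨x, hx⟩).2
      omega
    · simp only [hx, dif_neg, not_false_eq_true]
      omega
  · intro A hA
    rw [h.edgeSet_eq] at hA
    obtain ⟨hAk, Q, hQ, hAQ⟩ := hA
    obtain ⟨x, hx, y, hy, hxy⟩ :=
      (Set.one_lt_ncard_iff_nontrivial_and_finite.1 (by omega : 1 < A.ncard)).1
    have hm : ∀ z ∈ A, z ∈ hUfin.toFinset := fun z hz =>
      (Set.Finite.mem_toFinset hUfin).2 ⟨Q, hQ, hAQ hz⟩
    refine ⟨x, hx, y, hy, ?_⟩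
    simp only [hm x hx, hm y hy, dif_pos]
    intro hc
    exact hxy (congrArg Subtype.val (g.injective (Fin.ext hc)))

/-- For `1 ≤ q` there is a system with exactly `e` cliques: take pairwise disjoint ones. -/
theorem systemChromaticNumbers_nonempty (ℓ e q k : ℕ) (hq : 1 ≤ q) :
    (systemChromaticNumbers ℓ e q k).Nonempty := by
  let Q : Fin e → Set (Fin e × Fin q) := fun i => {p | p.1 = i}
  have hinj : Function.Injective Q := by
    intro i j hij
    have : ((i, ⟨0, hq⟩) : Fin e × Fin q) ∈ Q j := by
      rw [← hij]; rfl
    exact this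
  refine ⟨_, Fin e × Fin q, ⟨Set.univ, {A | A.ncard = k ∧ ∃ R ∈ Set.range Q, A ⊆ R},
    fun _ _ => Set.subset_univ _⟩, Set.range Q, ⟨Set.toFinite _, fun _ _ => Set.subset_univ _,
    ?_, ?_, rfl⟩, ?_, rfl⟩
  · rintro _ ⟨i, rfl⟩
    have : Q i = Set.range (fun j : Fin q => (i, j)) := by
      ext ⟨a, b⟩
      simp [Q, eq_comm]
    rw [this, ← Set.image_univ, Set.ncard_image_of_injective _ (Prod.mk_right_injective i)]
    simp
  · rintro _ ⟨i, rfl⟩ _ ⟨j, rfl⟩ hij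
    have : Q i ∩ Q j = ∅ := by
      ext p
      simp only [Set.mem_inter_iff, Set.mem_empty_iff_false, iff_false]
      rintro ⟨h1, h2⟩
      exact hij (by rw [← (h1 : p.1 = i), ← (h2 : p.1 = j)])
    simp [this]
  · rw [← Set.image_univ, Set.ncard_image_of_injective _ hinj]
    simp

/-- The maximum in the definition of `f_ℓ(e,q,k)` exists. -/
theorem cliqueF_isGreatest (ℓ e q k : ℕ) (hk : 2 ≤ k) (hkq : k ≤ q) :
    IsGreatest (systemChromaticNumbers ℓ e q k) (cliqueF ℓ e q k) := by
  have hb : BddAbove (systemChromaticNumbers ℓ e q k) := by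
    refine ⟨e * q + 1, ?_⟩
    rintro _ ⟨V, H, 𝒬, h, rfl, rfl⟩
    exact Nat.sInf_le (h.hasProperColoring hk)
  exact ⟨Nat.sSup_mem (systemChromaticNumbers_nonempty ℓ e q k (by omega)) hb,
    fun _ hx => le_csSup hb hx⟩

/-! Upper bound. Choose `R` of order `e^(1/(2k-2))`, so that `D = R^(k-1)` satisfies `2e < D^2`.
Double counting shows that fewer than `D` vertices of a linear system have degree at least `D`.
Split the vertices into low and high degree. A low vertex lies in fewer than `D` cliques. A high
vertex lies in fewer than `D` cliques that contain a second high vertex, because by linearity those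
second vertices are distinct. So the edges inside either part have degree at most `D q^(k-1) = (R
q)^(k-1)`. A counting argument in the style of Rosenfeld, used in place of the Local Lemma
(`exists_proper_coloring_of_degree_le`), colours each part with `2qR` colours. Disjoint palettes
take care of the edges that cross.

Lower bound. Take `n` of order `q^2 √e` vertices and choose `e` functions `Fin q → Fin n` one after
another, each compatible with linearity. If every `s`-set of vertices receives `k` values of some
chosen function, then no colour class has `s` vertices and the chromatic number is at least `n/s`. A
uniformly random compatible function hits a given `S` at least `k` times with probability at least
about `C(q,k) (s/n)^k`, as long as degrees are small and few earlier functions hit `S` twice. After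
`e` steps the union bound over at most `n^s` sets works once `e q^k (s/n)^k` exceeds a constant
times `s log n`. This gives `n/s` of order `(√e q^(k-2) / log e)^(1/(k-1))`.

The random process is derandomised (`exists_greedy_family`): one potential controls the degrees, the
double hits and the sets still missed, and some choice never increases it. Compatibility is
estimated by counting pairs of points already linked (`card_piFinset_sdiff_compatible_le`), with
separate bounds for pairs inside `S`, pairs with one point in `S`, and pairs outside `S`. -/

/-! ### Colouring uniform hypergraphs of bounded degree by counting -/

/-- The colour classes of `c` contain no member of `ℰ` that lies inside `S`. -/
def ProperOn {W β : Type*} (ℰ : Finset (Finset W)) (S : Finset W) (c : W → β) : Prop :=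
  ∀ A ∈ ℰ, A ⊆ S → ∃ x ∈ A, ∃ y ∈ A, c x ≠ c y

open scoped Classical in
/-- The functions `W → Fin r` that are proper on the edges inside `S`. -/
noncomputable def properFunctions {W : Type*} [Fintype W] (ℰ : Finset (Finset W)) (r : ℕ)
    (S : Finset W) : Finset (W → Fin r) :=
  {c | ProperOn ℰ S c}

theorem ProperOn.mono {W β : Type*} {ℰ : Finset (Finset W)} {S S' : Finset W} {c : W → β}
    (h : ProperOn ℰ S c) (hS : S' ⊆ S) : ProperOn ℰ S' c :=
  fun A hA hAS => h A hA (hAS.trans hS)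

theorem ProperOn.congr {W β : Type*} {ℰ : Finset (Finset W)} {S : Finset W} {c c' : W → β}
    (h : ProperOn ℰ S c) (hc : ∀ x ∈ S, c' x = c x) : ProperOn ℰ S c' := by
  intro A hA hAS
  obtain ⟨x, hx, y, hy, hxy⟩ := h A hA hAS
  exact ⟨x, hx, y, hy, by rwa [hc x (hAS hx), hc y (hAS hy)]⟩

open scoped Classical in
/-- Recolouring all but one vertex of a monochromatic set `A` arbitrarily. -/
theorem card_properFunctions_monochromatic_mul_le {W : Type*} [Fintype W] (ℰ : Finset (Finset W))
    (r : ℕ) (S A : Finset W) (u : W) (hu : u ∈ A) :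
    (((properFunctions ℰ r S).filter fun c => ∀ x ∈ A, c x = c u).card) * r ^ (A.card - 1) ≤
      (properFunctions ℰ r (S \ A.erase u)).card := by
  have h1 : Fintype.card (A.erase u → Fin r) = r ^ (A.card - 1) := by
    rw [Fintype.card_fun, Fintype.card_fin, Fintype.card_coe, Finset.card_erase_of_mem hu]
  rw [← h1, ← Finset.card_univ, ← Finset.card_product]
  refine Finset.card_le_card_of_injOn
    (fun p x => if hx : x ∈ A.erase u then p.2 ⟨x, hx⟩ else p.1 x) ?_ ?_
  · rintro ⟨c, g⟩ hp
    simp only [Finset.coe_product, Set.mem_prod, Finset.mem_coe, Finset.mem_filter,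
      properFunctions, Finset.mem_univ, true_and] at hp ⊢
    refine (hp.1.1.mono Finset.sdiff_subset).congr fun x hx => ?_
    rw [dif_neg (Finset.mem_sdiff.1 hx).2]
  · rintro ⟨c, g⟩ hp ⟨c', g'⟩ hp' heq
    simp only [Finset.coe_product, Set.mem_prod, Finset.mem_coe, Finset.mem_filter,
      properFunctions, Finset.mem_univ, true_and] at hp hp'
    have hcu : ∀ x, x ∉ A.erase u → c x = c' x := fun x hx => by
      have := congrFun heq x
      simpa only [dif_neg hx] using this
    have hg : g = g' := by
      ext ⟨x, hx⟩
      have := congrFun heq x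
      simp only [dif_pos hx] at this
      rw [this]
    -- Nothing is lost by overwriting: `c` is constant on `A`, so its old values are read off at
    -- `u`, which keeps its colour.
    have hc : c = c' := by
      ext x
      by_cases hx : x ∈ A.erase u
      · have hxA := Finset.mem_of_mem_erase hx
        rw [hp.1.2 x hxA, hp'.1.2 x hxA, hcu u (Finset.notMem_erase u A)]
      · rw [hcu x hx]
    rw [hc, hg]

/-- The vertices of `B` are removed one at a time. Vertices outside the set carry arbitrary colours,
so counts for different sets are comparable without powers of `r`. -/
theorem card_properFunctions_le_two_pow_mul {W : Type*} [Fintype W] [DecidableEq W]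
    (ℰ : Finset (Finset W)) (r : ℕ) (S : Finset W)
    (h : ∀ S' ⊆ S, ∀ v ∈ S', (properFunctions ℰ r (S'.erase v)).card
      ≤ 2 * (properFunctions ℰ r S').card) (B : Finset W) (hB : B ⊆ S) :
    (properFunctions ℰ r (S \ B)).card ≤ 2 ^ B.card * (properFunctions ℰ r S).card := by
  induction B using Finset.induction_on with
  | empty => simp
  | insert b B hb ih =>
    have h1 := ih ((Finset.subset_insert b B).trans hB)
    have h2 := h (S \ B) Finset.sdiff_subset b
      (Finset.mem_sdiff.2 ⟨hB (Finset.mem_insert_self b B), hb⟩)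
    rw [← Finset.sdiff_insert] at h2
    rw [Finset.card_insert_of_notMem hb, pow_succ]
    calc _ ≤ _ := h2
      _ ≤ 2 * (2 ^ B.card * (properFunctions ℰ r S).card) := Nat.mul_le_mul_left _ h1
      _ = _ := by ring

open scoped Classical in
/-- Adding one vertex loses at most half of the proper functions. -/
theorem card_properFunctions_erase_le {W : Type*} [Fintype W] (ℰ : Finset (Finset W))
    (k r Δ : ℕ) (hk : 2 ≤ k) (hr : 1 ≤ r) (hcard : ∀ A ∈ ℰ, A.card = k)
    (hdeg : ∀ v, (ℰ.filter fun A => v ∈ A).card ≤ Δ) (hΔ : Δ * 2 ^ (k - 1) ≤ r ^ (k - 1))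
    (S : Finset W) : ∀ v ∈ S, (properFunctions ℰ r (S.erase v)).card
      ≤ 2 * (properFunctions ℰ r S).card := by
  induction S using Finset.strongInduction with
  | H S ih =>
  intro v hv
  set S₀ := S.erase v with hS₀
  have hlt : S₀ ⊂ S := Finset.erase_ssubset hv
  set N := (properFunctions ℰ r S₀).card with hN
  -- Keep the colour of some `u ≠ v` in `A` and free the other `k - 1` vertices. Only `k - 2` of
  -- these lie in `S₀`, so by induction freeing them costs a factor `2 ^ (k - 2)`, while recolouring
  -- gains `r ^ (k - 1)`.
  have hmono : ∀ A ∈ ℰ.filter (fun A => v ∈ A),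
      (((properFunctions ℰ r S₀).filter fun c => A ⊆ S ∧ ∀ x ∈ A, c x = c v).card) * r ^ (k - 1)
        ≤ 2 ^ (k - 2) * N := by
    intro A hA
    obtain ⟨hAE, hvA⟩ := Finset.mem_filter.1 hA
    by_cases hAS : A ⊆ S
    swap
    · simp [hAS]
    obtain ⟨u, huA, huv⟩ : ∃ u ∈ A, u ≠ v :=
      Finset.exists_mem_ne (by rw [hcard A hAE]; omega) v
    have h1 := card_properFunctions_monochromatic_mul_le ℰ r S₀ A u huA
    have h2 : S₀ \ A.erase u = S₀ \ (A.erase u).erase v := by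
      ext x
      simp only [hS₀, Finset.mem_sdiff, Finset.mem_erase]
      tauto
    have h3 := card_properFunctions_le_two_pow_mul ℰ r S₀
      (fun S' hS' w hw => ih S' (lt_of_le_of_lt hS' hlt) w hw) ((A.erase u).erase v) (by
        intro x hx
        simp only [Finset.mem_erase] at hx
        exact Finset.mem_erase.2 ⟨hx.1, hAS hx.2.2⟩)
    have h4 : ((A.erase u).erase v).card = k - 2 := by
      rw [Finset.card_erase_of_mem (Finset.mem_erase.2 ⟨huv.symm, hvA⟩),
        Finset.card_erase_of_mem huA, hcard A hAE]
      omega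
    rw [h4, ← h2] at h3
    rw [hcard A hAE] at h1
    refine le_trans (Nat.mul_le_mul_right _ (Finset.card_le_card ?_)) (h1.trans h3)
    intro c hc
    simp only [Finset.mem_filter] at hc ⊢
    exact ⟨hc.1, fun x hx => (hc.2.2 x hx).trans (hc.2.2 u huA).symm⟩
  have hcover : properFunctions ℰ r S₀ ⊆ properFunctions ℰ r S ∪
      (ℰ.filter fun A => v ∈ A).biUnion fun A =>
        (properFunctions ℰ r S₀).filter fun c => A ⊆ S ∧ ∀ x ∈ A, c x = c v := by
    intro c hc
    by_cases hcS : ProperOn ℰ S c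
    · exact Finset.mem_union_left _ (by simp [properFunctions, hcS])
    · refine Finset.mem_union_right _ ?_
      simp only [ProperOn, not_forall] at hcS
      obtain ⟨A, hA, hAS, hno⟩ := hcS
      push Not at hno
      have hvA : v ∈ A := by
        by_contra hvA
        have hc' : ProperOn ℰ S₀ c := by simpa [properFunctions] using hc
        obtain ⟨x, hx, y, hy, hxy⟩ := hc' A hA (fun x hx =>
          Finset.mem_erase.2 ⟨fun h => hvA (h ▸ hx), hAS hx⟩)
        exact hxy (hno x hx y hy)
      exact Finset.mem_biUnion.2 ⟨A, Finset.mem_filter.2 ⟨hA, hvA⟩,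
        Finset.mem_filter.2 ⟨hc, hAS, fun x hx => hno x hx v hvA⟩⟩
  have hle := (Finset.card_le_card hcover).trans (Finset.card_union_le _ _)
  have hbU := (Finset.card_biUnion_le (s := ℰ.filter fun A => v ∈ A) (t := fun A =>
        (properFunctions ℰ r S₀).filter fun c => A ⊆ S ∧ ∀ x ∈ A, c x = c v))
  set X := ((ℰ.filter fun A => v ∈ A).biUnion fun A =>
        (properFunctions ℰ r S₀).filter fun c => A ⊆ S ∧ ∀ x ∈ A, c x = c v).card with hX
  have hXr : X * r ^ (k - 1) ≤ Δ * (2 ^ (k - 2) * N) := by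
    calc X * r ^ (k - 1) ≤ _ := Nat.mul_le_mul_right _ hbU
      _ = _ := Finset.sum_mul _ _ _
      _ ≤ _ := Finset.sum_le_card_nsmul _ _ _ hmono
      _ ≤ Δ * (2 ^ (k - 2) * N) := Nat.mul_le_mul_right _ (hdeg v)
  have h2 : 2 * X ≤ N := by
    have hpos : 0 < r ^ (k - 1) := pow_pos (by omega) _
    refine Nat.le_of_mul_le_mul_right ?_ hpos
    have hpow : 2 ^ (k - 1) = 2 * 2 ^ (k - 2) := by
      rw [← pow_succ']
      congr 1
      omega
    calc 2 * X * r ^ (k - 1) = 2 * (X * r ^ (k - 1)) := by ring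
      _ ≤ 2 * (Δ * (2 ^ (k - 2) * N)) := Nat.mul_le_mul_left _ hXr
      _ = N * (Δ * 2 ^ (k - 1)) := by rw [hpow]; ring
      _ ≤ N * r ^ (k - 1) := Nat.mul_le_mul_left _ hΔ
  change N ≤ _ at hle
  omega

open scoped Classical in
/-- A `k`-uniform hypergraph of maximum degree `Δ ≤ (r / 2) ^ (k - 1)` is `r`-colourable. -/
theorem exists_proper_coloring_of_degree_le {W : Type*} [Fintype W] (ℰ : Finset (Finset W))
    (k r Δ : ℕ) (hk : 2 ≤ k) (hr : 1 ≤ r) (hcard : ∀ A ∈ ℰ, A.card = k)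
    (hdeg : ∀ v, (ℰ.filter fun A => v ∈ A).card ≤ Δ) (hΔ : Δ * 2 ^ (k - 1) ≤ r ^ (k - 1)) :
    ∃ c : W → Fin r, ∀ A ∈ ℰ, ∃ x ∈ A, ∃ y ∈ A, c x ≠ c y := by
  have h := card_properFunctions_le_two_pow_mul ℰ r Finset.univ
    (fun S' _ v hv => card_properFunctions_erase_le ℰ k r Δ hk hr hcard hdeg hΔ S' v hv)
    Finset.univ subset_rfl
  have h0 : 0 < (properFunctions ℰ r (Finset.univ \ Finset.univ)).card := by
    refine Finset.card_pos.2 ⟨fun _ => ⟨0, hr⟩, ?_⟩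
    simp only [properFunctions, Finset.mem_filter, Finset.mem_univ, true_and, sdiff_self]
    intro A hA hAS
    have h1 := hcard A hA
    rw [Finset.subset_empty.1 hAS, Finset.card_empty] at h1
    omega
  obtain ⟨c, hc⟩ := Finset.card_pos.1 (Nat.pos_of_mul_pos_left (h0.trans_le h))
  simp only [properFunctions, Finset.mem_filter, Finset.mem_univ, true_and] at hc
  exact ⟨c, fun A hA => hc A hA (Finset.subset_univ A)⟩

/-! ### The upper bound: splitting by degree -/

/-- The edges of a clique system that lie in `Y` can be properly coloured with `2 q R` colours if
every vertex of `Y` is in at most `R ^ (k - 1)` cliques that meet `Y` twice. -/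
theorem exists_proper_coloring_inside {W : Type*} [Fintype W] [DecidableEq W]
    (𝒬 : Finset (Finset W)) (q k R : ℕ) (hk : 2 ≤ k) (hq : 1 ≤ q) (hR : 1 ≤ R)
    (hcard : ∀ Q ∈ 𝒬, Q.card = q) (Y : Finset W)
    (hY : ∀ v ∈ Y, (𝒬.filter fun Q => v ∈ Q ∧ 2 ≤ (Q ∩ Y).card).card ≤ R ^ (k - 1)) :
    ∃ c : W → Fin (2 * q * R), ∀ A : Finset W, A.card = k → A ⊆ Y → (∃ Q ∈ 𝒬, A ⊆ Q) →
      ∃ x ∈ A, ∃ y ∈ A, c x ≠ c y := by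
  classical
  let ℰ : Finset (Finset W) :=
    (Finset.univ : Finset (Finset W)).filter fun A => A.card = k ∧ A ⊆ Y ∧ ∃ Q ∈ 𝒬, A ⊆ Q
  have hdeg : ∀ v, (ℰ.filter fun A => v ∈ A).card ≤ R ^ (k - 1) * q ^ (k - 1) := by
    intro v
    by_cases hv : v ∈ Y
    swap
    · rw [Finset.filter_eq_empty_iff.2, Finset.card_empty]
      · exact Nat.zero_le _
      · intro A hA hvA
        simp only [ℰ, Finset.mem_filter] at hA
        exact hv (hA.2.2.1 hvA)
    have hsub : ℰ.filter (fun A => v ∈ A) ⊆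
        (𝒬.filter fun Q => v ∈ Q ∧ 2 ≤ (Q ∩ Y).card).biUnion
          fun Q => (Q.powersetCard (k - 1)).image (insert v) := by
      intro A hA
      simp only [ℰ, Finset.mem_filter, Finset.mem_univ, true_and] at hA
      obtain ⟨⟨hAk, hAY, Q, hQ, hAQ⟩, hvA⟩ := hA
      refine Finset.mem_biUnion.2 ⟨Q, Finset.mem_filter.2 ⟨hQ, hAQ hvA, ?_⟩, ?_⟩
      · have := Finset.card_le_card (Finset.subset_inter hAQ hAY)
        omega
      · refine Finset.mem_image.2 ⟨A.erase v, Finset.mem_powersetCard.2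
          ⟨(Finset.erase_subset v A).trans hAQ, ?_⟩, Finset.insert_erase hvA⟩
        rw [Finset.card_erase_of_mem hvA, hAk]
    refine (Finset.card_le_card hsub).trans ((Finset.card_biUnion_le_card_mul _ _
      (q ^ (k - 1)) ?_).trans (Nat.mul_le_mul_right _ (hY v hv)))
    intro Q hQ
    refine Finset.card_image_le.trans ?_
    rw [Finset.card_powersetCard, hcard Q (Finset.mem_filter.1 hQ).1]
    exact Nat.choose_le_pow q (k - 1)
  -- The degree bound `(q R)^(k-1)` is exactly `(r/2)^(k-1)` for `r = 2 q R`.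
  obtain ⟨c, hc⟩ := exists_proper_coloring_of_degree_le ℰ k (2 * q * R)
    (R ^ (k - 1) * q ^ (k - 1)) hk
    (Nat.mul_pos (by omega) hR) (fun A hA => by simp only [ℰ, Finset.mem_filter] at hA; exact hA.2.1)
    (fun v => by convert hdeg v) (by rw [mul_pow, mul_pow]; exact le_of_eq (by ring))
  exact ⟨c, fun A hAk hAY hAQ => hc A (by simp [ℰ, hAk, hAY, hAQ])⟩

/-- In a linear system of fewer than `D ^ 2 / 2` sets, fewer than `D` vertices have degree at
least `D`. -/
theorem card_high_degree_lt {W : Type*} [Fintype W] [DecidableEq W] (𝒬 : Finset (Finset W))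
    (D : ℕ) (hlin : ∀ Q ∈ 𝒬, ∀ Q' ∈ 𝒬, Q ≠ Q' → (Q ∩ Q').card ≤ 1)
    (hD : 2 * 𝒬.card < D ^ 2) :
    ((Finset.univ : Finset W).filter fun v => D ≤ (𝒬.filter fun Q => v ∈ Q).card).card < D := by
  by_contra! hcon
  obtain ⟨Y, hYs, hYD⟩ := Finset.exists_subset_card_eq hcon
  have h1 : D * D ≤ ∑ Q ∈ 𝒬, (Q ∩ Y).card := by
    have : ∑ Q ∈ 𝒬, (Q ∩ Y).card = ∑ v ∈ Y, (𝒬.filter fun Q => v ∈ Q).card := by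
      refine Eq.trans ?_ (Finset.sum_card_bipartiteAbove_eq_sum_card_bipartiteBelow (s := 𝒬)
        (t := Y) fun Q v => v ∈ Q)
      refine Finset.sum_congr rfl fun Q _ => congrArg Finset.card ?_
      ext v
      simp [Finset.bipartiteAbove, and_comm]
    rw [this]
    calc D * D = Y.card • D := by rw [hYD, smul_eq_mul]
      _ ≤ _ := Finset.card_nsmul_le_sum _ _ _ fun v hv => (Finset.mem_filter.1 (hYs hv)).2
  have h2 : ∑ Q ∈ 𝒬, ((Q ∩ Y).offDiag).card ≤ Y.offDiag.card := by
    rw [← Finset.card_biUnion]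
    · refine Finset.card_le_card ?_
      intro p hp
      simp only [Finset.mem_biUnion, Finset.mem_offDiag, Finset.mem_inter] at hp ⊢
      obtain ⟨Q, _, h1, h2, h3⟩ := hp
      exact ⟨h1.2, h2.2, h3⟩
    · intro Q hQ Q' hQ' hne
      rw [Function.onFun, Finset.disjoint_left]
      rintro ⟨x, y⟩ hp hp'
      simp only [Finset.mem_offDiag, Finset.mem_inter] at hp hp'
      exact hp.2.2 (Finset.card_le_one.1 (hlin Q hQ Q' hQ' hne) x
        (Finset.mem_inter.2 ⟨hp.1.1, hp'.1.1⟩) y (Finset.mem_inter.2 ⟨hp.2.1.1, hp'.2.1.1⟩))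
  rw [Finset.offDiag_card, hYD] at h2
  -- This is `2a ≤ a(a-1) + 2`. Summed over the sets it gives `2D² ≤ D² - D + 2|𝒬|`, contradicting
  -- `2|𝒬| < D²`.
  have h3 : ∑ Q ∈ 𝒬, 2 * (Q ∩ Y).card ≤ ∑ Q ∈ 𝒬, (((Q ∩ Y).offDiag).card + 2) := by
    refine Finset.sum_le_sum fun Q _ => ?_
    rw [Finset.offDiag_card]
    generalize (Q ∩ Y).card = a
    rcases a with _ | _ | a
    · omega
    · omega
    · have : (a + 1 + 1) * (a + 1 + 1) - (a + 1 + 1) = (a + 1) * (a + 1 + 1) := by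
        rw [Nat.sub_eq_iff_eq_add (Nat.le_mul_self _)]; ring
      rw [this]
      nlinarith
  rw [← Finset.mul_sum, Finset.sum_add_distrib, Finset.sum_const, smul_eq_mul] at h3
  have h4 : D * D - D ≤ D * D := Nat.sub_le _ _
  rw [pow_two] at hD
  omega

/-- A linear system of fewer than `R ^ (2 k - 2) / 2` cliques has a proper colouring with `4 q R`
colours: the vertices of high degree and those of low degree get disjoint palettes. -/
theorem exists_proper_coloring_of_linear {W : Type*} [Fintype W] [DecidableEq W]
    (𝒬 : Finset (Finset W)) (q k R : ℕ) (hk : 2 ≤ k) (hq : 1 ≤ q) (hR : 1 ≤ R)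
    (hcard : ∀ Q ∈ 𝒬, Q.card = q)
    (hlin : ∀ Q ∈ 𝒬, ∀ Q' ∈ 𝒬, Q ≠ Q' → (Q ∩ Q').card ≤ 1)
    (hD : 2 * 𝒬.card < (R ^ (k - 1)) ^ 2) :
    ∃ c : W → Fin (4 * q * R), ∀ A : Finset W, A.card = k → (∃ Q ∈ 𝒬, A ⊆ Q) →
      ∃ x ∈ A, ∃ y ∈ A, c x ≠ c y := by
  set D := R ^ (k - 1)
  set Hi := (Finset.univ : Finset W).filter fun v => D ≤ (𝒬.filter fun Q => v ∈ Q).card with hHi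
  have hHiD : Hi.card < D := card_high_degree_lt 𝒬 D hlin hD
  obtain ⟨c₀, hc₀⟩ := exists_proper_coloring_inside 𝒬 q k R hk hq hR hcard Hiᶜ (by
    intro v hv
    have h1 : (𝒬.filter fun Q => v ∈ Q).card < D := by simpa [hHi] using hv
    refine le_trans (Finset.card_le_card fun Q hQ => ?_) h1.le
    simp only [Finset.mem_filter] at hQ ⊢
    exact ⟨hQ.1, hQ.2.1⟩)
  obtain ⟨c₁, hc₁⟩ := exists_proper_coloring_inside 𝒬 q k R hk hq hR hcard Hi (by
    intro v hv
    have : Nonempty W := ⟨v⟩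
    -- Two cliques through `v` with the same second vertex `w` in `Hi` would share two points, so `Q
    -- ↦ w Q` is injective into `Hi`.
    have hex : ∀ Q ∈ 𝒬.filter (fun Q => v ∈ Q ∧ 2 ≤ (Q ∩ Hi).card),
        ∃ w ∈ Q ∩ Hi, w ≠ v := by
      intro Q hQ
      exact Finset.exists_mem_ne (Finset.mem_filter.1 hQ).2.2 v
    choose! w hw hwv using hex
    refine (Finset.card_le_card_of_injOn w (fun Q hQ => (Finset.mem_inter.1 (hw Q hQ)).2)
      ?_).trans hHiD.le
    intro Q hQ Q' hQ' heq
    by_contra hne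
    have h1 := Finset.mem_filter.1 hQ
    have h2 := Finset.mem_filter.1 hQ'
    have h3 := (Finset.mem_inter.1 (hw Q' hQ')).1
    rw [← heq] at h3
    exact hwv Q hQ (Finset.card_le_one.1 (hlin Q h1.1 Q' h2.1 hne) (w Q)
      (Finset.mem_inter.2 ⟨(Finset.mem_inter.1 (hw Q hQ)).1, h3⟩) v
      (Finset.mem_inter.2 ⟨h1.2.1, h2.2.1⟩)))
  have hpal : 4 * q * R = 2 * q * R + 2 * q * R := by ring
  refine ⟨fun x => if x ∈ Hi then (Fin.natAdd (2 * q * R) (c₁ x)).cast hpal.symm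
    else (Fin.castAdd (2 * q * R) (c₀ x)).cast hpal.symm, fun A hA hAQ => ?_⟩
  by_contra! hmono
  have hval : ∀ x ∈ A, ∀ y ∈ A, (if x ∈ Hi then 2 * q * R + (c₁ x : ℕ) else (c₀ x : ℕ)) =
      (if y ∈ Hi then 2 * q * R + (c₁ y : ℕ) else (c₀ y : ℕ)) := by
    intro x hx y hy
    have h := congrArg Fin.val (hmono x hx y hy)
    by_cases hxH : x ∈ Hi <;> by_cases hyH : y ∈ Hi <;>
      simpa [hxH, hyH, add_comm] using h
  by_cases hall : A ⊆ Hi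
  · obtain ⟨x, hx, y, hy, hxy⟩ := hc₁ A hA hall hAQ
    have h := hval x hx y hy
    rw [if_pos (hall hx), if_pos (hall hy)] at h
    exact hxy (Fin.ext (by omega))
  · obtain ⟨z, hz, hzH⟩ := Finset.not_subset.1 hall
    have hlow : A ⊆ Hiᶜ := by
      intro x hx
      rw [Finset.mem_compl]
      intro hxH
      have h := hval x hx z hz
      rw [if_pos hxH, if_neg hzH] at h
      have := (c₀ z).2
      omega
    obtain ⟨x, hx, y, hy, hxy⟩ := hc₀ A hA hlow hAQ
    have h := hval x hx y hy
    rw [if_neg (Finset.mem_compl.1 (hlow hx)), if_neg (Finset.mem_compl.1 (hlow hy))] at h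
    exact hxy (Fin.ext h)

theorem IsCliqueSystem.hasProperColoring_of_lt {V : Type*} {q k : ℕ} {H : Hypergraph V}
    {𝒬 : Set (Set V)} (h : IsCliqueSystem 1 q k H 𝒬) (hk : 2 ≤ k) (hq : 1 ≤ q) (R : ℕ) (hR : 1 ≤ R)
    (he : 2 * 𝒬.ncard < (R ^ (k - 1)) ^ 2) :
    HasProperColoring H (4 * q * R) := by
  classical
  have hfin : 𝒬.Finite :=
    h.finite_vertexSet.finite_subsets.subset fun Q hQ => h.subset_vertexSet Q hQ
  have : Fintype H.vertexSet := h.finite_vertexSet.fintype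
  let φ : Set V → Finset H.vertexSet := fun Q => Finset.univ.filter fun x => (x : V) ∈ Q
  have hφ : ∀ Q : Set V, Q ⊆ H.vertexSet →
      ((φ Q).map (Function.Embedding.subtype _) : Set V) = Q := by
    intro Q hQ
    ext x
    simp only [φ, Finset.coe_map, Set.mem_image, Finset.mem_coe, Finset.mem_filter,
      Finset.mem_univ, true_and, Function.Embedding.coe_subtype, Subtype.exists, exists_and_left,
      exists_prop, exists_eq_right_right]
    exact ⟨fun hx => hx.1, fun hx => ⟨hx, hQ hx⟩⟩
  have hφcard : ∀ Q : Set V, Q ⊆ H.vertexSet → (φ Q).card = Q.ncard := by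
    intro Q hQ
    conv_rhs => rw [← hφ Q hQ]
    rw [Set.ncard_coe_finset, Finset.card_map]
  have hφinter : ∀ Q Q' : Set V, φ Q ∩ φ Q' = φ (Q ∩ Q') := by
    intro Q Q'
    ext x
    simp [φ]
  obtain ⟨c, hc⟩ := exists_proper_coloring_of_linear (hfin.toFinset.image φ) q k R hk hq hR
    (by
      intro Q hQ
      obtain ⟨Q₀, hQ₀, rfl⟩ := Finset.mem_image.1 hQ
      rw [Set.Finite.mem_toFinset] at hQ₀
      rw [hφcard _ (h.subset_vertexSet _ hQ₀), h.ncard_clique _ hQ₀])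
    (by
      intro Q hQ Q' hQ' hne
      obtain ⟨Q₀, hQ₀, rfl⟩ := Finset.mem_image.1 hQ
      obtain ⟨Q₁, hQ₁, rfl⟩ := Finset.mem_image.1 hQ'
      rw [Set.Finite.mem_toFinset] at hQ₀ hQ₁
      rw [hφinter, hφcard _ (Set.inter_subset_left.trans (h.subset_vertexSet _ hQ₀))]
      exact h.ncard_inter_le _ hQ₀ _ hQ₁ fun he => hne (by rw [he]))
    (by
      refine lt_of_le_of_lt (Nat.mul_le_mul_left 2 ?_) he
      rw [Set.ncard_eq_toFinset_card _ hfin]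
      exact Finset.card_image_le)
  have hpos : 0 < 4 * q * R := Nat.mul_pos (by omega) hR
  refine ⟨fun x => if hx : x ∈ H.vertexSet then (c ⟨x, hx⟩ : ℕ) else 0, ?_, ?_⟩
  · intro x hx
    simp only [dif_pos hx]
    exact (c ⟨x, hx⟩).2
  · intro A hA
    rw [h.edgeSet_eq] at hA
    obtain ⟨hAk, Q, hQ, hAQ⟩ := hA
    have hAV := hAQ.trans (h.subset_vertexSet Q hQ)
    obtain ⟨x, hx, y, hy, hxy⟩ := hc (φ A) (by rw [hφcard A hAV, hAk])
      ⟨φ Q, Finset.mem_image_of_mem _ ((Set.Finite.mem_toFinset hfin).2 hQ), fun x hx => by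
        simp only [φ, Finset.mem_filter, Finset.mem_univ, true_and] at hx ⊢
        exact hAQ hx⟩
    simp only [φ, Finset.mem_filter, Finset.mem_univ, true_and] at hx hy
    refine ⟨x, hx, y, hy, ?_⟩
    simp only [dif_pos x.2, dif_pos y.2]
    exact fun he => hxy (Fin.ext he)

theorem cliqueF_le_of_lt (k q e R : ℕ) (hk : 2 ≤ k) (hkq : k ≤ q) (hR : 1 ≤ R)
    (he : 2 * e < (R ^ (k - 1)) ^ 2) : cliqueF 1 e q k ≤ 4 * q * R := by
  obtain ⟨V, H, 𝒬, h, rfl, hχ⟩ := (cliqueF_isGreatest 1 e q k hk hkq).1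
  rw [← hχ]
  exact Nat.sInf_le (h.hasProperColoring_of_lt hk (by omega) R hR he)

theorem cliqueF_upper_bound (k : ℕ) (hk : 3 ≤ k) : ∃ C : ℝ, ∀ q e : ℕ, k ≤ q → 1 ≤ e →
    (cliqueF 1 e q k : ℝ) < C * (e : ℝ) ^ (1 / (2 * (k : ℝ) - 2)) * (q : ℝ) := by
  -- With `R ≤ 2y + 1 ≤ 3y` the number of colours is `4qR ≤ 12 y q`. The factor `2` in `2y` absorbs
  -- that of `2e < R^(2k-2)`.
  refine ⟨13, fun q e hkq he => ?_⟩
  set y : ℝ := (e : ℝ) ^ (1 / (2 * (k : ℝ) - 2)) with hy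
  have he1 : (1 : ℝ) ≤ e := by exact_mod_cast he
  have hk3 : (3 : ℝ) ≤ k := by exact_mod_cast hk
  have hy1 : 1 ≤ y := Real.one_le_rpow he1 (by
    apply div_nonneg zero_le_one; linarith)
  have hyk : y ^ (2 * (k - 1)) = e := by
    rw [hy, ← Real.rpow_natCast, ← Real.rpow_mul (by linarith)]
    have : 1 / (2 * (k : ℝ) - 2) * ((2 * (k - 1) : ℕ) : ℝ) = 1 := by
      rw [Nat.cast_mul, Nat.cast_sub (by omega)]
      push_cast
      rw [div_mul_eq_mul_div, div_eq_one_iff_eq (by linarith)]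
      ring
    rw [this, Real.rpow_one]
  set R := ⌊2 * y⌋₊ + 1 with hR
  have hRy : 2 * y < R := by rw [hR]; exact_mod_cast Nat.lt_floor_add_one (2 * y)
  have hRy' : (R : ℝ) ≤ 2 * y + 1 := by
    rw [hR]; push_cast; linarith [Nat.floor_le (by linarith : 0 ≤ 2 * y)]
  have hle := cliqueF_le_of_lt k q e R (by omega) hkq (by omega) (by
    have h1 : (2 * y) ^ (2 * (k - 1)) < (R : ℝ) ^ (2 * (k - 1)) :=
      pow_lt_pow_left₀ hRy (by linarith) (by omega)
    rw [mul_pow, hyk] at h1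
    have h2 : (2 : ℝ) ^ 1 ≤ 2 ^ (2 * (k - 1)) := pow_le_pow_right₀ one_le_two (by omega)
    have h3 : (2 : ℝ) * e < (R : ℝ) ^ (2 * (k - 1)) :=
      lt_of_le_of_lt (by nlinarith) h1
    rw [← pow_mul, mul_comm (k - 1) 2]
    exact_mod_cast h3)
  have hq0 : (0 : ℝ) < q := by exact_mod_cast (by omega : 0 < q)
  calc (cliqueF 1 e q k : ℝ) ≤ ((4 * q * R : ℕ) : ℝ) := by exact_mod_cast hle
    _ = 4 * q * R := by push_cast; ring
    _ ≤ 4 * q * (2 * y + 1) := by gcongr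
    _ < 13 * y * q := by nlinarith

/-! ### Method of conditional expectations -/

/-- The exponential weight of a family `P` with respect to the tests `G i`, where `T - P.card`
further members are still to be added to `P`. -/
noncomputable def hitWeight {α ι : Type*} [DecidableEq α] (I : Finset ι) (G : ι → Finset α) (ρ : ℝ)
    (T : ℕ) (P : Finset α) : ℝ :=
  ∑ i ∈ I, 2 ^ (P ∩ G i).card * (1 + ρ) ^ (T - P.card)

/-- The weighted number of tests in `I` that no member of `P` meets. -/
noncomputable def missWeight {α ι : Type*} [DecidableEq α] (I : Finset ι) (G : ι → Finset α)
    (p : ℝ) (T : ℕ) (P : Finset α) : ℝ :=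
  ∑ i ∈ I, if Disjoint P (G i) then (1 - p) ^ (T - P.card) else 0

/-- For `f` uniform in `C`, the factor `2^[f ∈ G i]` has mean at most `1 + ρ`. This is the factor
that the weight gives up when one fewer choice remains. -/
theorem sum_hitWeight_insert_le {α ι : Type*} [DecidableEq α] (I : Finset ι) (G : ι → Finset α)
    (ρ : ℝ) (hρ : 0 ≤ ρ) (T : ℕ) (P C : Finset α) (hPT : P.card < T) (hC : Disjoint C P)
    (h : ∀ i ∈ I, ((C ∩ G i).card : ℝ) ≤ ρ * C.card) :
    ∑ f ∈ C, hitWeight I G ρ T (insert f P) ≤ C.card * hitWeight I G ρ T P := by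
  unfold hitWeight
  rw [Finset.sum_comm, Finset.mul_sum]
  refine Finset.sum_le_sum fun i hi => ?_
  have hterm : ∀ f ∈ C, (2 : ℝ) ^ (insert f P ∩ G i).card * (1 + ρ) ^ (T - (insert f P).card) =
      (2 ^ (P ∩ G i).card * (1 + ρ) ^ (T - P.card - 1)) * (1 + if f ∈ G i then 1 else 0) := by
    intro f hf
    have hfP : f ∉ P := Finset.disjoint_left.1 hC hf
    rw [Finset.card_insert_of_notMem hfP, ← Nat.sub_sub]
    by_cases hfG : f ∈ G i
    · rw [Finset.insert_inter_of_mem hfG, Finset.card_insert_of_notMem (by simp [hfP]), if_pos hfG,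
        pow_succ]
      ring
    · rw [Finset.insert_inter_of_notMem hfG, if_neg hfG]
      ring
  rw [Finset.sum_congr rfl hterm, ← Finset.mul_sum, Finset.sum_add_distrib, Finset.sum_const,
    Finset.sum_boole, Finset.filter_mem_eq_inter, nsmul_eq_mul, mul_one]
  have hT : T - P.card = T - P.card - 1 + 1 := by omega
  rw [hT, pow_succ]
  simp only [Nat.add_sub_cancel]
  have h0 : (0 : ℝ) ≤ 2 ^ (P ∩ G i).card * (1 + ρ) ^ (T - P.card - 1) := by positivity
  nlinarith [h i hi, mul_le_mul_of_nonneg_left (h i hi) h0]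

/-- A test that is still unmet stays unmet with probability at most `1 - p`, which cancels the power
of `1 - p` lost in the weight. A test already met contributes nothing from then on. -/
theorem sum_missWeight_insert_le {α ι : Type*} [DecidableEq α] (I : Finset ι) (G : ι → Finset α)
    (p : ℝ) (hp : p ≤ 1) (T : ℕ) (P C : Finset α) (hPT : P.card < T) (hC : Disjoint C P)
    (h : ∀ i ∈ I, Disjoint P (G i) → p * C.card ≤ ((C ∩ G i).card : ℝ)) :
    ∑ f ∈ C, missWeight I G p T (insert f P) ≤ C.card * missWeight I G p T P := by
  unfold missWeight
  rw [Finset.sum_comm, Finset.mul_sum]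
  refine Finset.sum_le_sum fun i hi => ?_
  have h0 : 0 ≤ (1 - p) ^ (T - P.card - 1) := pow_nonneg (by linarith) _
  by_cases hd : Disjoint P (G i)
  · have hterm : ∀ f ∈ C, (if Disjoint (insert f P) (G i) then
        (1 - p) ^ (T - (insert f P).card) else 0) =
        (1 - p) ^ (T - P.card - 1) * (1 - if f ∈ G i then 1 else 0) := by
      intro f hf
      rw [Finset.card_insert_of_notMem (Finset.disjoint_left.1 hC hf), ← Nat.sub_sub]
      by_cases hfG : f ∈ G i <;> simp [Finset.disjoint_insert_left, hfG, hd]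
    rw [Finset.sum_congr rfl hterm, ← Finset.mul_sum, Finset.sum_sub_distrib, Finset.sum_const,
      Finset.sum_boole, Finset.filter_mem_eq_inter, nsmul_eq_mul, mul_one, if_pos hd]
    have hT : T - P.card = T - P.card - 1 + 1 := by omega
    rw [hT, pow_succ]
    simp only [Nat.add_sub_cancel]
    nlinarith [mul_le_mul_of_nonneg_left (h i hi hd) h0]
  · rw [if_neg hd, mul_zero]
    refine le_of_eq (Finset.sum_eq_zero fun f _ => ?_)
    rw [if_neg]
    rw [Finset.disjoint_insert_left]
    exact fun h => hd h.2

theorem card_inter_lt_of_hitWeight_lt {α ι : Type*} [DecidableEq α] {I : Finset ι}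
    {G : ι → Finset α} {ρ : ℝ} (hρ : 0 ≤ ρ) {T D : ℕ} {P : Finset α}
    (h : hitWeight I G ρ T P < 2 ^ D) {i : ι} (hi : i ∈ I) : (P ∩ G i).card < D := by
  have h1 : (2 : ℝ) ^ (P ∩ G i).card * (1 + ρ) ^ (T - P.card) ≤ hitWeight I G ρ T P :=
    Finset.single_le_sum (f := fun i => (2 : ℝ) ^ (P ∩ G i).card * (1 + ρ) ^ (T - P.card))
      (fun _ _ => by positivity) hi
  have h2 : (1 : ℝ) ≤ (1 + ρ) ^ (T - P.card) := one_le_pow₀ (by linarith)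
  have h3 : (2 : ℝ) ^ (P ∩ G i).card < 2 ^ D := by
    have : (0 : ℝ) < 2 ^ (P ∩ G i).card := by positivity
    nlinarith
  exact (pow_lt_pow_iff_right₀ one_lt_two).1 h3

theorem hitWeight_nonneg {α ι : Type*} [DecidableEq α] (I : Finset ι) (G : ι → Finset α) {ρ : ℝ}
    (hρ : 0 ≤ ρ) (T : ℕ) (P : Finset α) : 0 ≤ hitWeight I G ρ T P :=
  Finset.sum_nonneg fun _ _ => by positivity

theorem missWeight_nonneg {α ι : Type*} [DecidableEq α] (I : Finset ι) (G : ι → Finset α) {p : ℝ}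
    (hp : p ≤ 1) (T : ℕ) (P : Finset α) : 0 ≤ missWeight I G p T P := by
  exact Finset.sum_nonneg fun _ _ => by
    split_ifs
    · exact pow_nonneg (by linarith) _
    · exact le_rfl

/-- A greedy choice of `T` objects that meets every test `Z j`, while the numbers of hits of the
tests `G i` and `F j` stay below `D` and `K`: the method of conditional expectations. -/
theorem exists_greedy_family {α ι κ : Type*} [DecidableEq α] (valid : Finset α → Prop)
    (C : Finset α → Finset α) (I : Finset ι) (J : Finset κ) (G : ι → Finset α) (F Z : κ → Finset α)
    (ρ₁ ρ₂ p : ℝ) (D K T : ℕ) (hρ₁ : 0 ≤ ρ₁) (hρ₂ : 0 ≤ ρ₂) (hp : p ≤ 1) (h0 : valid ∅)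
    (hinit : I.card * (1 + ρ₁) ^ T / 2 ^ D + J.card * (1 + ρ₂) ^ T / 2 ^ K + J.card * (1 - p) ^ T
      < 1)
    (hins : ∀ P, valid P → ∀ f ∈ C P, f ∉ P ∧ valid (insert f P))
    (hstep : ∀ P, valid P → P.card < T → (∀ i ∈ I, (P ∩ G i).card < D) →
      (∀ j ∈ J, (P ∩ F j).card < K) → (C P).Nonempty ∧
      (∀ i ∈ I, ((C P ∩ G i).card : ℝ) ≤ ρ₁ * (C P).card) ∧
      (∀ j ∈ J, ((C P ∩ F j).card : ℝ) ≤ ρ₂ * (C P).card) ∧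
      (∀ j ∈ J, Disjoint P (Z j) → p * (C P).card ≤ ((C P ∩ Z j).card : ℝ))) :
    ∃ P, valid P ∧ P.card = T ∧ ∀ j ∈ J, ¬ Disjoint P (Z j) := by
  -- Keeping `Φ < 1` forces the first two terms below `1`, which gives the hit bounds that `hstep`
  -- asks for. At `P.card = T` the third term counts the unmet tests, so there are none.
  let Φ : Finset α → ℝ := fun P => hitWeight I G ρ₁ T P / 2 ^ D + hitWeight J F ρ₂ T P / 2 ^ K +
    missWeight J Z p T P
  have key : ∀ t ≤ T, ∃ P, valid P ∧ P.card = t ∧ Φ P < 1 := by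
    intro t
    induction t with
    | zero =>
      intro _
      refine ⟨∅, h0, Finset.card_empty, ?_⟩
      simpa [Φ, hitWeight, missWeight] using hinit
    | succ t ih =>
      intro ht
      obtain ⟨P, hP, hPt, hΦ⟩ := ih (by omega)
      have n1 := hitWeight_nonneg I G hρ₁ T P
      have n2 := hitWeight_nonneg J F hρ₂ T P
      have n3 := missWeight_nonneg J Z hp T P
      have d1 : 0 ≤ hitWeight I G ρ₁ T P / 2 ^ D := by positivity
      have d2 : 0 ≤ hitWeight J F ρ₂ T P / 2 ^ K := by positivity
      have l1 : hitWeight I G ρ₁ T P < 2 ^ D := by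
        rw [← div_lt_one (by positivity)]
        simp only [Φ] at hΦ
        linarith
      have l2 : hitWeight J F ρ₂ T P < 2 ^ K := by
        rw [← div_lt_one (by positivity)]
        simp only [Φ] at hΦ
        linarith
      obtain ⟨hne, s1, s2, s3⟩ := hstep P hP (by omega)
        (fun i hi => card_inter_lt_of_hitWeight_lt hρ₁ l1 hi)
        (fun j hj => card_inter_lt_of_hitWeight_lt hρ₂ l2 hj)
      have hdis : Disjoint (C P) P := Finset.disjoint_left.2 fun f hf => (hins P hP f hf).1
      have hPT : P.card < T := by omega
      have e1 := sum_hitWeight_insert_le I G ρ₁ hρ₁ T P (C P) hPT hdis s1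
      have e2 := sum_hitWeight_insert_le J F ρ₂ hρ₂ T P (C P) hPT hdis s2
      have e3 := sum_missWeight_insert_le J Z p hp T P (C P) hPT hdis s3
      have hsum : ∑ f ∈ C P, Φ (insert f P) ≤ ∑ f ∈ C P, Φ P := by
        simp only [Φ, Finset.sum_add_distrib, ← Finset.sum_div, Finset.sum_const, nsmul_eq_mul]
        have e1' := div_le_div_of_nonneg_right e1 (by positivity : (0 : ℝ) ≤ 2 ^ D)
        have e2' := div_le_div_of_nonneg_right e2 (by positivity : (0 : ℝ) ≤ 2 ^ K)
        linarith
      obtain ⟨f, hf, hle⟩ := Finset.exists_le_of_sum_le hne hsum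
      obtain ⟨hfP, hval⟩ := hins P hP f hf
      exact ⟨insert f P, hval, by rw [Finset.card_insert_of_notMem hfP, hPt], hle.trans_lt hΦ⟩
  obtain ⟨P, hP, hPT, hΦ⟩ := key T le_rfl
  refine ⟨P, hP, hPT, fun j hj hd => ?_⟩
  have d1 : 0 ≤ hitWeight I G ρ₁ T P / 2 ^ D := div_nonneg (hitWeight_nonneg I G hρ₁ T P)
    (by positivity)
  have d2 : 0 ≤ hitWeight J F ρ₂ T P / 2 ^ K := div_nonneg (hitWeight_nonneg J F hρ₂ T P)
    (by positivity)
  have d3 : (1 : ℝ) ≤ missWeight J Z p T P := by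
    have := Finset.single_le_sum
      (f := fun j => if Disjoint P (Z j) then (1 - p) ^ (T - P.card) else 0)
      (fun j _ => by
        split_ifs
        · exact pow_nonneg (by linarith) _
        · exact le_rfl) hj
    simpa [hd, hPT, missWeight] using this
  simp only [Φ] at hΦ
  linarith

/-! ### Linear families and linked pairs -/

/-- Restricting two coordinates of a product of finite sets to a relation. -/
theorem card_piFinset_filter_mul_le {ι β : Type*} [Fintype ι] [DecidableEq ι] [DecidableEq β]
    (X : ι → Finset β) {i j : ι} (hij : i ≠ j) (R : Finset (β × β)) :
    ((Fintype.piFinset X).filter fun f => (f i, f j) ∈ R).card * ((X i).card * (X j).card) ≤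
      R.card * ∏ l, (X l).card := by
  have hprod : ∀ g : ι → ℕ, ∏ l, g l = g i * g j * ∏ l ∈ (Finset.univ.erase i).erase j, g l := by
    intro g
    rw [← Finset.mul_prod_erase _ _ (Finset.mem_univ i),
      ← Finset.mul_prod_erase (Finset.univ.erase i) g
        (Finset.mem_erase.2 ⟨hij.symm, Finset.mem_univ j⟩), mul_assoc]
  set M := ∏ l ∈ (Finset.univ.erase i).erase j, (X l).card with hM
  have hfib : ((Fintype.piFinset X).filter fun f => (f i, f j) ∈ R).card ≤ M * R.card := by
    refine Finset.card_le_mul_card_image_of_maps_to (f := fun f : ι → β => (f i, f j))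
      (fun f hf => (Finset.mem_filter.1 hf).2) M fun r _ => ?_
    let Y : ι → Finset β := Function.update (Function.update X i {r.1}) j {r.2}
    have hY : (Fintype.piFinset Y).card = M := by
      rw [Fintype.card_piFinset, hprod]
      have h1 : Y i = {r.1} := by simp [Y, hij]
      have h2 : Y j = {r.2} := by simp [Y]
      rw [h1, h2, Finset.card_singleton, Finset.card_singleton, one_mul, one_mul, hM]
      refine Finset.prod_congr rfl fun l hl => ?_
      simp only [Finset.mem_erase, Finset.mem_univ, and_true] at hl
      simp [Y, hl.1, hl.2]
    rw [← hY]
    refine Finset.card_le_card fun f hf => ?_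
    simp only [Finset.mem_filter, Fintype.mem_piFinset] at hf
    rw [Fintype.mem_piFinset]
    intro l
    by_cases hlj : l = j
    · subst hlj
      simp [Y, ← hf.2]
    · by_cases hli : l = i
      · subst hli
        simp [Y, ← hf.2, hlj]
      · simpa [Y, hlj, hli] using hf.1.1 l
  rw [hprod fun l => (X l).card, ← hM]
  calc _ ≤ M * R.card * ((X i).card * (X j).card) := Nat.mul_le_mul_right _ hfib
    _ = _ := by ring

theorem card_piFinset_filter_le_of_le {ι β : Type*} [Fintype ι] [DecidableEq ι] [DecidableEq β]
    (X : ι → Finset β) {i j : ι} (hij : i ≠ j) (R : Finset (β × β)) {b : ℝ} (hi : (X i).Nonempty)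
    (hj : (X j).Nonempty) (hR : (R.card : ℝ) ≤ b * ((X i).card * (X j).card)) :
    (((Fintype.piFinset X).filter fun f => (f i, f j) ∈ R).card : ℝ) ≤
      b * ∏ l, ((X l).card : ℝ) := by
  have hpos : (0 : ℝ) < (X i).card * (X j).card := by
    have := hi.card_pos
    have := hj.card_pos
    positivity
  have h1 : (((Fintype.piFinset X).filter fun f => (f i, f j) ∈ R).card : ℝ) *
      ((X i).card * (X j).card) ≤ R.card * ∏ l, ((X l).card : ℝ) := by
    exact_mod_cast card_piFinset_filter_mul_le X hij R
  refine le_of_mul_le_mul_right (h1.trans ?_) hpos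
  calc _ ≤ b * ((X i).card * (X j).card) * ∏ l, ((X l).card : ℝ) :=
        mul_le_mul_of_nonneg_right hR (by positivity)
    _ = _ := by ring

/-- `u` and `v` are equal or lie in the range of a common member of `P`. -/
def Linked {ι β : Type*} (P : Finset (ι → β)) (u v : β) : Prop :=
  u = v ∨ ∃ g ∈ P, u ∈ Set.range g ∧ v ∈ Set.range g

/-- A set of injective functions whose ranges pairwise share at most one point. -/
def IsLinearFamily {ι β : Type*} (P : Finset (ι → β)) : Prop :=
  (∀ g ∈ P, Function.Injective g) ∧ ∀ g ∈ P, ∀ h ∈ P, g ≠ h →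
    ∀ u ∈ Set.range g ∩ Set.range h, ∀ v ∈ Set.range g ∩ Set.range h, u = v

open scoped Classical in
/-- The functions that take no two values that are linked by `P`. -/
noncomputable def compatible {ι β : Type*} [Fintype ι] [DecidableEq ι] [Fintype β]
    (P : Finset (ι → β)) : Finset (ι → β) :=
  {f | ∀ i j, i ≠ j → ¬ Linked P (f i) (f j)}

/-- The number of arguments that `f` maps into `S`. -/
def hits {ι β : Type*} [Fintype ι] [DecidableEq β] (S : Finset β) (f : ι → β) : ℕ :=
  (Finset.univ.filter fun i => f i ∈ S).card

open scoped Classical in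
/-- The pairs in `X × Y` that are linked by `P`. -/
noncomputable def linkedPairs {ι β : Type*} (P : Finset (ι → β)) (X Y : Finset β) :
    Finset (β × β) :=
  (X ×ˢ Y).filter fun p => Linked P p.1 p.2

theorem Linked.symm {ι β : Type*} {P : Finset (ι → β)} {u v : β} (h : Linked P u v) :
    Linked P v u := by
  rcases h with h | ⟨g, hg, hu, hv⟩
  · exact Or.inl h.symm
  · exact Or.inr ⟨g, hg, hv, hu⟩

theorem card_linkedPairs_comm {ι β : Type*} (P : Finset (ι → β)) (X Y : Finset β) :
    (linkedPairs P X Y).card ≤ (linkedPairs P Y X).card := by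
  refine Finset.card_le_card_of_injOn Prod.swap (fun p hp => ?_) Prod.swap_injective.injOn
  simp only [linkedPairs, Finset.coe_filter, Finset.mem_product, Set.mem_ofPred_eq,
    Prod.fst_swap, Prod.snd_swap] at hp ⊢
  exact ⟨⟨hp.1.2, hp.1.1⟩, hp.2.symm⟩

/-- A second common point of `f` and some `g ∈ P` would link two values of `f`. Since equal points
count as linked, `f` is injective. Two distinct arguments are needed to exclude `f ∈ P`. -/
theorem IsLinearFamily.insert {ι β : Type*} [Fintype ι] [DecidableEq ι] [Fintype β] [DecidableEq β]
    [Nontrivial ι] {P : Finset (ι → β)} (hP : IsLinearFamily P) {f : ι → β}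
    (hf : f ∈ compatible P) : f ∉ P ∧ IsLinearFamily (insert f P) := by
  have hf' : ∀ i j, i ≠ j → ¬ Linked P (f i) (f j) := by simpa [compatible] using hf
  have hnew : ∀ g ∈ P, ∀ u ∈ Set.range f ∩ Set.range g, ∀ v ∈ Set.range f ∩ Set.range g,
      u = v := by
    rintro g hg _ ⟨⟨i, rfl⟩, hi⟩ _ ⟨⟨j, rfl⟩, hj⟩
    by_contra hne
    exact hf' i j (fun h => hne (by rw [h])) (Or.inr ⟨g, hg, hi, hj⟩)
  have hinj : Function.Injective f := fun i j hij => by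
    by_contra hne
    exact hf' i j hne (Or.inl hij)
  refine ⟨fun hfP => ?_, fun g hg => ?_, fun g hg h hh hgh => ?_⟩
  · obtain ⟨i, j, hij⟩ := exists_pair_ne ι
    exact hf' i j hij (Or.inr ⟨f, hfP, ⟨i, rfl⟩, ⟨j, rfl⟩⟩)
  · rcases Finset.mem_insert.1 hg with rfl | hg
    · exact hinj
    · exact hP.1 g hg
  · rcases Finset.mem_insert.1 hg with rfl | hgP <;> rcases Finset.mem_insert.1 hh with rfl | hhP
    · exact absurd rfl hgh
    · exact hnew h hhP
    · intro u hu v hv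
      exact hnew g hgP u hu.symm v hv.symm
    · exact hP.2 g hgP h hhP hgh

/-- The crude global bound, good enough when both sets have order `n`. -/
theorem card_linkedPairs_le {ι β : Type*} [Fintype ι] [DecidableEq β]
    (P : Finset (ι → β)) (X Y : Finset β) :
    (linkedPairs P X Y).card ≤ X.card + P.card * Fintype.card ι ^ 2 := by
  have hsub : linkedPairs P X Y ⊆ X.image (fun u => (u, u)) ∪
      P.biUnion fun g => Finset.univ.image g ×ˢ Finset.univ.image g := by
    rintro ⟨u, v⟩ hp
    simp only [linkedPairs, Finset.mem_filter, Finset.mem_product] at hp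
    rcases hp.2 with h | ⟨g, hg, ⟨i, hi⟩, ⟨j, hj⟩⟩
    · obtain rfl : u = v := h
      exact Finset.mem_union_left _ (Finset.mem_image.2 ⟨u, hp.1.1, rfl⟩)
    · refine Finset.mem_union_right _ (Finset.mem_biUnion.2 ⟨g, hg, Finset.mem_product.2 ⟨?_, ?_⟩⟩)
      · exact Finset.mem_image.2 ⟨i, Finset.mem_univ i, hi⟩
      · exact Finset.mem_image.2 ⟨j, Finset.mem_univ j, hj⟩
  refine (Finset.card_le_card hsub).trans ((Finset.card_union_le _ _).trans
    (Nat.add_le_add Finset.card_image_le (Finset.card_biUnion_le_card_mul _ _ _ fun g _ => ?_)))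
  rw [Finset.card_product, pow_two]
  exact Nat.mul_le_mul Finset.card_image_le Finset.card_image_le

open scoped Classical in
-- Meant for pairs with one point in the small set `S`: each point is linked to itself and to at
-- most `D` ranges.
theorem card_linkedPairs_le_of_degree {ι β : Type*} [Fintype ι] (P : Finset (ι → β))
    (X Y : Finset β) (D : ℕ) (hD : ∀ v ∈ X, (P.filter fun g => v ∈ Set.range g).card ≤ D) :
    (linkedPairs P X Y).card ≤ X.card * (1 + D * Fintype.card ι) := by
  have hsub : linkedPairs P X Y ⊆ X.biUnion fun u => (insert u
      ((P.filter fun g => u ∈ Set.range g).biUnion fun g => Finset.univ.image g)).image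
        fun v => (u, v) := by
    rintro ⟨u, v⟩ hp
    simp only [linkedPairs, Finset.mem_filter, Finset.mem_product] at hp
    refine Finset.mem_biUnion.2 ⟨u, hp.1.1, Finset.mem_image.2 ⟨v, ?_, rfl⟩⟩
    rcases hp.2 with h | ⟨g, hg, hu, ⟨j, hj⟩⟩
    · exact Finset.mem_insert.2 (Or.inl h.symm)
    · exact Finset.mem_insert_of_mem (Finset.mem_biUnion.2 ⟨g, Finset.mem_filter.2 ⟨hg, hu⟩,
        Finset.mem_image.2 ⟨j, Finset.mem_univ j, hj⟩⟩)
  refine (Finset.card_le_card hsub).trans (Finset.card_biUnion_le_card_mul _ _ _ fun u hu => ?_)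
  refine Finset.card_image_le.trans ((Finset.card_insert_le _ _).trans ?_)
  rw [add_comm]
  refine Nat.add_le_add_left ((Finset.card_biUnion_le_card_mul _ _ (Fintype.card ι)
    fun g _ => Finset.card_image_le).trans (Nat.mul_le_mul_right _ (hD u hu))) 1

/-- Links inside `S` between distinct points come only from members that hit `S` at least twice, and
each of these gives at most `k²` pairs. -/
theorem card_linkedPairs_self_le {ι β : Type*} [Fintype ι] [DecidableEq β] (P : Finset (ι → β))
    (S : Finset β) (k K : ℕ) (hK : (P.filter fun g => 2 ≤ hits S g).card ≤ K)
    (hk : ∀ g ∈ P, hits S g ≤ k) :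
    (linkedPairs P S S).card ≤ S.card + K * k ^ 2 := by
  have hsub : linkedPairs P S S ⊆ S.image (fun u => (u, u)) ∪
      (P.filter fun g => 2 ≤ hits S g).biUnion fun g =>
        (Finset.univ.filter fun i => g i ∈ S).image g ×ˢ
          (Finset.univ.filter fun i => g i ∈ S).image g := by
    rintro ⟨u, v⟩ hp
    simp only [linkedPairs, Finset.mem_filter, Finset.mem_product] at hp
    by_cases h : u = v
    · subst h
      exact Finset.mem_union_left _ (Finset.mem_image.2 ⟨u, hp.1.1, rfl⟩)
    rcases hp.2 with h' | ⟨g, hg, ⟨i, hi⟩, ⟨j, hj⟩⟩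
    · exact absurd h' h
    have hiS : i ∈ Finset.univ.filter fun i => g i ∈ S := by simp [hi, hp.1.1]
    have hjS : j ∈ Finset.univ.filter fun i => g i ∈ S := by simp [hj, hp.1.2]
    refine Finset.mem_union_right _ (Finset.mem_biUnion.2 ⟨g, Finset.mem_filter.2 ⟨hg, ?_⟩,
      Finset.mem_product.2 ⟨Finset.mem_image.2 ⟨i, hiS, hi⟩, Finset.mem_image.2 ⟨j, hjS, hj⟩⟩⟩)
    exact Finset.one_lt_card.2 ⟨i, hiS, j, hjS, fun hij => h (by rw [← hi, ← hj, hij])⟩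
  refine (Finset.card_le_card hsub).trans ((Finset.card_union_le _ _).trans
    (Nat.add_le_add Finset.card_image_le ((Finset.card_biUnion_le_card_mul _ _ (k ^ 2)
      fun g hg => ?_).trans (Nat.mul_le_mul_right _ hK))))
  rw [Finset.card_product, pow_two]
  have := hk g (Finset.mem_filter.1 hg).1
  exact Nat.mul_le_mul (Finset.card_image_le.trans this) (Finset.card_image_le.trans this)

/-- Union bound over pairs of arguments, where `b i j` bounds the probability that the values at `i`
and `j` are linked. -/
theorem card_piFinset_sdiff_compatible_le {ι β : Type*} [Fintype ι] [DecidableEq ι] [Fintype β]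
    [DecidableEq β] (P : Finset (ι → β)) (X : ι → Finset β) (hX : ∀ i, (X i).Nonempty)
    (b : ι → ι → ℝ) (hb : ∀ i j, 0 ≤ b i j)
    (h : ∀ i j, i ≠ j →
      ((linkedPairs P (X i) (X j)).card : ℝ) ≤ b i j * ((X i).card * (X j).card)) :
    ((Fintype.piFinset X \ compatible P).card : ℝ) ≤
      (∑ i, ∑ j, b i j) * ∏ l, ((X l).card : ℝ) := by
  have hsub : Fintype.piFinset X \ compatible P ⊆
      (Finset.univ : Finset ι).offDiag.biUnion fun p =>
        (Fintype.piFinset X).filter fun f => (f p.1, f p.2) ∈ linkedPairs P (X p.1) (X p.2) := by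
    intro f hf
    simp only [compatible, Finset.mem_sdiff, Finset.mem_filter, Finset.mem_univ, true_and,
      not_forall, not_not] at hf
    obtain ⟨hfX, i, j, hij, hl⟩ := hf
    refine Finset.mem_biUnion.2 ⟨(i, j), by simpa using hij, Finset.mem_filter.2 ⟨hfX, ?_⟩⟩
    rw [Fintype.mem_piFinset] at hfX
    simp [linkedPairs, hfX i, hfX j, hl]
  have h1 : ((Fintype.piFinset X \ compatible P).card : ℝ) ≤
      ∑ p ∈ (Finset.univ : Finset ι).offDiag, b p.1 p.2 * ∏ l, ((X l).card : ℝ) := by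
    refine le_trans (by exact_mod_cast (Finset.card_le_card hsub).trans Finset.card_biUnion_le)
      (?_ : ((∑ p ∈ (Finset.univ : Finset ι).offDiag, ((Fintype.piFinset X).filter fun f =>
        (f p.1, f p.2) ∈ linkedPairs P (X p.1) (X p.2)).card : ℕ) : ℝ) ≤ _)
    push_cast
    refine Finset.sum_le_sum fun p hp => ?_
    have hne : p.1 ≠ p.2 := by simpa using hp
    exact card_piFinset_filter_le_of_le X hne _ (hX _) (hX _) (h _ _ hne)
  refine h1.trans ?_
  rw [← Finset.sum_mul, ← Finset.sum_product' (f := b)]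
  refine mul_le_mul_of_nonneg_right (Finset.sum_le_sum_of_subset_of_nonneg
    (fun p _ => by simp) fun p _ _ => hb _ _) (Finset.prod_nonneg fun _ _ => by positivity)

/-! ### Probabilities for a random compatible function -/

section Counting

variable {q n : ℕ} (P : Finset (Fin q → Fin n))

theorem half_le_card_compatible (hn : 4 * q ^ 2 ≤ n) (hn0 : 0 < n)
    (hn2 : 4 * P.card * q ^ 4 ≤ n ^ 2) : (n : ℝ) ^ q / 2 ≤ (compatible P).card := by
  have hn0' : (0 : ℝ) < n := by exact_mod_cast hn0
  have : NeZero n := ⟨hn0.ne'⟩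
  have h := card_piFinset_sdiff_compatible_le P (fun _ => Finset.univ)
    (fun _ => Finset.univ_nonempty) (fun _ _ => (n + P.card * q ^ 2) / (n : ℝ) ^ 2)
    (fun _ _ => by positivity) (fun i j _ => by
      have := card_linkedPairs_le P Finset.univ Finset.univ
      simp only [Finset.card_univ, Fintype.card_fin] at this ⊢
      rw [← pow_two, div_mul_cancel₀ _ (by positivity)]
      exact_mod_cast this)
  simp only [Finset.sum_const, Finset.card_univ, Fintype.card_fin, Finset.prod_const,
    nsmul_eq_mul] at h
  have hU : Fintype.piFinset (fun _ : Fin q => (Finset.univ : Finset (Fin n))) = Finset.univ := by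
    simp
  rw [hU] at h
  have h2 : ((Finset.univ \ compatible P).card : ℝ) + (compatible P).card = (n : ℝ) ^ q := by
    have := Finset.card_sdiff_add_card_eq_card (Finset.subset_univ (compatible P))
    rw [Finset.card_univ, Fintype.card_fun, Fintype.card_fin, Fintype.card_fin] at this
    exact_mod_cast this
  have h3 : (q : ℝ) * (q * ((n + P.card * q ^ 2) / (n : ℝ) ^ 2)) ≤ 1 / 2 := by
    have e1 : (4 : ℝ) * q ^ 2 ≤ n := by exact_mod_cast hn
    have e2 : (4 : ℝ) * P.card * q ^ 4 ≤ n ^ 2 := by exact_mod_cast hn2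
    rw [mul_div_assoc', mul_div_assoc', div_le_iff₀ (by positivity)]
    nlinarith
  nlinarith [mul_le_mul_of_nonneg_right h3 (by positivity : (0 : ℝ) ≤ (n : ℝ) ^ q)]

theorem card_compatible_le : ((compatible P).card : ℝ) ≤ (n : ℝ) ^ q := by
  have := Finset.card_le_univ (compatible P)
  rw [Fintype.card_fun, Fintype.card_fin, Fintype.card_fin] at this
  exact_mod_cast this

open scoped Classical in
theorem card_filter_mem_range_le (hq : 2 ≤ q) (hn0 : 0 < n) (v : Fin n) :
    (((Finset.univ : Finset (Fin q → Fin n)).filter fun f => v ∈ Set.range f).card : ℝ) ≤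
      q / n * (n : ℝ) ^ q := by
  have hn0' : (0 : ℝ) < n := by exact_mod_cast hn0
  have : NeZero n := ⟨hn0.ne'⟩
  have : Nontrivial (Fin q) := Fin.nontrivial_iff_two_le.2 hq
  have hU : Fintype.piFinset (fun _ : Fin q => (Finset.univ : Finset (Fin n))) = Finset.univ := by
    simp
  have h1 : ∀ i : Fin q, (((Finset.univ : Finset (Fin q → Fin n)).filter fun f =>
      f i = v).card : ℝ) ≤ 1 / n * (n : ℝ) ^ q := by
    intro i
    obtain ⟨j, hj⟩ := exists_ne i
    have := card_piFinset_filter_le_of_le (fun _ : Fin q => (Finset.univ : Finset (Fin n)))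
      hj.symm (({v} : Finset (Fin n)) ×ˢ Finset.univ) (b := 1 / n) Finset.univ_nonempty
      Finset.univ_nonempty (by simp; field_simp; rfl)
    rw [hU] at this
    simpa [eq_comm] using this
  have hsub : (Finset.univ : Finset (Fin q → Fin n)).filter (fun f => v ∈ Set.range f) ⊆
      Finset.univ.biUnion fun i => Finset.univ.filter fun f => f i = v := by
    intro f hf
    obtain ⟨i, hi⟩ := (Finset.mem_filter.1 hf).2
    exact Finset.mem_biUnion.2 ⟨i, Finset.mem_univ i, by simp [hi]⟩
  calc _ ≤ ((∑ i : Fin q, ((Finset.univ : Finset (Fin q → Fin n)).filter fun f =>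
        f i = v).card : ℕ) : ℝ) := by
        exact_mod_cast (Finset.card_le_card hsub).trans Finset.card_biUnion_le
    _ ≤ ∑ i : Fin q, 1 / n * (n : ℝ) ^ q := by
        push_cast
        exact Finset.sum_le_sum fun i _ => h1 i
    _ = _ := by
        rw [Finset.sum_const, Finset.card_univ, Fintype.card_fin, nsmul_eq_mul]
        ring

theorem card_filter_two_le_hits_le (hn0 : 0 < n) (S : Finset (Fin n)) :
    (((Finset.univ : Finset (Fin q → Fin n)).filter fun f => 2 ≤ hits S f).card : ℝ) ≤
      (q * S.card / n) ^ 2 * (n : ℝ) ^ q := by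
  have hn0' : (0 : ℝ) < n := by exact_mod_cast hn0
  have : NeZero n := ⟨hn0.ne'⟩
  have hU : Fintype.piFinset (fun _ : Fin q => (Finset.univ : Finset (Fin n))) = Finset.univ := by
    simp
  have h1 : ∀ p ∈ (Finset.univ : Finset (Fin q)).offDiag,
      (((Finset.univ : Finset (Fin q → Fin n)).filter fun f =>
      (f p.1, f p.2) ∈ S ×ˢ S).card : ℝ) ≤ (S.card / n : ℝ) ^ 2 * (n : ℝ) ^ q := by
    intro p hp
    have := card_piFinset_filter_le_of_le (fun _ : Fin q => (Finset.univ : Finset (Fin n)))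
      (by simpa using hp : p.1 ≠ p.2) (S ×ˢ S) (b := (S.card / n : ℝ) ^ 2) Finset.univ_nonempty
      Finset.univ_nonempty (by simp; field_simp; rfl)
    rw [hU] at this
    simpa using this
  have hsub : (Finset.univ : Finset (Fin q → Fin n)).filter (fun f => 2 ≤ hits S f) ⊆
      (Finset.univ : Finset (Fin q)).offDiag.biUnion fun p =>
        Finset.univ.filter fun f => (f p.1, f p.2) ∈ S ×ˢ S := by
    intro f hf
    obtain ⟨i, hi, j, hj, hij⟩ := Finset.one_lt_card.1 (Finset.mem_filter.1 hf).2
    exact Finset.mem_biUnion.2 ⟨(i, j), by simpa using hij, by simp at hi hj ⊢; exact ⟨hi, hj⟩⟩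
  calc _ ≤ ((∑ p ∈ (Finset.univ : Finset (Fin q)).offDiag,
        ((Finset.univ : Finset (Fin q → Fin n)).filter fun f =>
          (f p.1, f p.2) ∈ S ×ˢ S).card : ℕ) : ℝ) := by
        exact_mod_cast (Finset.card_le_card hsub).trans Finset.card_biUnion_le
    _ ≤ ∑ p ∈ (Finset.univ : Finset (Fin q)).offDiag, (S.card / n : ℝ) ^ 2 * (n : ℝ) ^ q := by
        push_cast
        exact Finset.sum_le_sum fun p hp => by exact_mod_cast h1 p hp
    _ ≤ (q * q : ℕ) * ((S.card / n : ℝ) ^ 2 * (n : ℝ) ^ q) := by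
        rw [Finset.sum_const, nsmul_eq_mul]
        refine mul_le_mul_of_nonneg_right ?_ (by positivity)
        rw [Finset.offDiag_card, Finset.card_univ, Fintype.card_fin]
        exact_mod_cast Nat.sub_le _ _
    _ = _ := by push_cast; ring

end Counting

theorem sum_sum_add_mul_add_mul_mul {ι : Type*} [Fintype ι] (x : ι → ℝ) (b₁ b₂ b₃ : ℝ) :
    ∑ i, ∑ j, (b₃ + b₂ * (x i + x j) + b₁ * (x i * x j)) =
      Fintype.card ι ^ 2 * b₃ + 2 * Fintype.card ι * (∑ i, x i) * b₂ + (∑ i, x i) ^ 2 * b₁ := by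
  simp only [Finset.sum_add_distrib, ← Finset.mul_sum, ← Finset.sum_mul, Finset.sum_const,
    Finset.card_univ, nsmul_eq_mul]
  ring

section Counting

variable {q n : ℕ} (P : Finset (Fin q → Fin n))

open scoped Classical in
/-- Half of the functions that map exactly the elements of `I` into `S` are compatible with `P`. -/
theorem half_le_card_compatible_inter_piFinset {k D K : ℕ} (hk : 1 ≤ k) (S : Finset (Fin n))
    (I : Finset (Fin q)) (hI : I.card = k)
    (hS : 16 * k ^ 2 ≤ S.card) (hKS : 16 * k ^ 4 * K ≤ S.card ^ 2) (hSn : 2 * S.card ≤ n)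
    (hDn : 32 * q * k * (1 + D * q) ≤ n) (hqn : 32 * q ^ 2 ≤ n)
    (hPn : 32 * P.card * q ^ 4 ≤ n ^ 2)
    (hdeg : ∀ v, (P.filter fun g => v ∈ Set.range g).card ≤ D)
    (hK : (P.filter fun g => 2 ≤ hits S g).card ≤ K) (hP : ∀ g ∈ P, hits S g ≤ k) :
    (S.card : ℝ) ^ k * (n - S.card : ℝ) ^ (q - k) / 2 ≤
      ((compatible P ∩ Fintype.piFinset fun i => if i ∈ I then S else Sᶜ).card : ℝ) := by
  have hspos : 0 < S.card := lt_of_lt_of_le (by positivity) hS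
  have hnpos : 0 < n := by omega
  have hs0 : (0 : ℝ) < S.card := by exact_mod_cast hspos
  have hn0 : (0 : ℝ) < n := by exact_mod_cast hnpos
  have hSn' : 2 * (S.card : ℝ) ≤ n := by exact_mod_cast hSn
  have hScard : ((Sᶜ).card : ℝ) = n - S.card := by
    rw [Finset.card_compl, Fintype.card_fin, Nat.cast_sub (by omega)]
  set X : Fin q → Finset (Fin n) := fun i => if i ∈ I then S else Sᶜ with hX
  have hXne : ∀ i, (X i).Nonempty := by
    intro i
    simp only [hX]
    split_ifs
    · exact Finset.card_pos.1 hspos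
    · rw [← Finset.card_pos, Finset.card_compl, Fintype.card_fin]
      omega
  have hXlow : ∀ i, S.card ≤ (X i).card := by
    intro i
    simp only [hX]
    split_ifs
    · exact le_rfl
    · rw [Finset.card_compl, Fintype.card_fin]
      omega
  have hXI : ∀ i ∈ I, X i = S := fun i hi => by simp [hX, hi]
  have hXc : ∀ i ∉ I, (n : ℝ) / 2 ≤ (X i).card := by
    intro i hi
    simp only [hX, if_neg hi, hScard]
    linarith
  -- Bounds for the link probability when both, one or neither of the two arguments is mapped into
  -- `S`.
  set b₁ : ℝ := (S.card + K * k ^ 2) / (S.card : ℝ) ^ 2 with hb₁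
  set b₂ : ℝ := 2 * (1 + D * q) / n with hb₂
  set b₃ : ℝ := 4 * (n + P.card * q ^ 2) / (n : ℝ) ^ 2 with hb₃
  have b₁0 : 0 ≤ b₁ := by positivity
  have b₂0 : 0 ≤ b₂ := by positivity
  have b₃0 : 0 ≤ b₃ := by positivity
  -- With indicators, `b₃ + b₂ (x i + x j) + b₁ x i x j` dominates the right bound in every case and
  -- its double sum has a closed form.
  let x : Fin q → ℝ := fun i => if i ∈ I then 1 else 0
  have hx0 : ∀ i, 0 ≤ x i := fun i => by
    simp only [x]; split_ifs <;> norm_num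
  have hxsum : ∑ i, x i = k := by
    simp [x, hI]
  have hmixed : ∀ i j, i ∈ I → j ∉ I →
      ((linkedPairs P (X i) (X j)).card : ℝ) ≤ b₂ * ((X i).card * (X j).card) := by
    intro i j hi hj
    rw [hXI i hi]
    have h1 : ((linkedPairs P S (X j)).card : ℝ) ≤ S.card * (1 + D * q) := by
      have := card_linkedPairs_le_of_degree P S (X j) D fun v _ => by convert hdeg v
      rw [Fintype.card_fin] at this
      exact_mod_cast this
    refine h1.trans ?_
    have h2 : b₂ * (S.card * (n / 2)) ≤ b₂ * ((S.card : ℝ) * (X j).card) :=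
      mul_le_mul_of_nonneg_left (mul_le_mul_of_nonneg_left (hXc j hj) hs0.le) b₂0
    refine le_trans (le_of_eq ?_) h2
    rw [hb₂, div_mul_eq_mul_div, eq_div_iff (by positivity)]
    ring
  have hloss := card_piFinset_sdiff_compatible_le P X hXne
    (fun i j => b₃ + b₂ * (x i + x j) + b₁ * (x i * x j))
    (fun i j => by
      have := hx0 i
      have := hx0 j
      positivity) (by
    intro i j _
    by_cases hi : i ∈ I <;> by_cases hj : j ∈ I
    · have h1 : ((linkedPairs P S S).card : ℝ) ≤ S.card + K * k ^ 2 := by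
        exact_mod_cast card_linkedPairs_self_le P S k K (by convert hK) hP
      have h2 : ((linkedPairs P S S).card : ℝ) ≤ b₁ * (S.card * S.card) := by
        rw [hb₁, ← pow_two, div_mul_cancel₀ _ (by positivity)]
        exact h1
      rw [hXI i hi, hXI j hj]
      refine h2.trans (mul_le_mul_of_nonneg_right ?_ (by positivity))
      simp only [x, if_pos hi, if_pos hj]
      linarith
    · refine (hmixed i j hi hj).trans (mul_le_mul_of_nonneg_right ?_ (by positivity))
      simp only [x, if_pos hi, if_neg hj]
      linarith
    · have h1 : ((linkedPairs P (X i) (X j)).card : ℝ) ≤ (linkedPairs P (X j) (X i)).card := by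
        exact_mod_cast card_linkedPairs_comm P (X i) (X j)
      refine (h1.trans (hmixed j i hj hi)).trans ?_
      rw [mul_comm ((X j).card : ℝ)]
      refine mul_le_mul_of_nonneg_right ?_ (by positivity)
      simp only [x, if_neg hi, if_pos hj]
      linarith
    · have h1 : ((linkedPairs P (X i) (X j)).card : ℝ) ≤ n + P.card * q ^ 2 := by
        have h2 := card_linkedPairs_le P (X i) (X j)
        have h3 := Finset.card_le_univ (X i)
        rw [Fintype.card_fin] at h2 h3
        exact_mod_cast h2.trans (Nat.add_le_add_right h3 _)
      refine h1.trans ?_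
      simp only [x, if_neg hi, if_neg hj]
      have h2 : (n : ℝ) / 2 * (n / 2) ≤ (X i).card * (X j).card :=
        mul_le_mul (hXc i hi) (hXc j hj) (by positivity) (by positivity)
      have h3 := mul_le_mul_of_nonneg_left h2 b₃0
      have h4 : b₃ * ((n : ℝ) / 2 * (n / 2)) = n + P.card * q ^ 2 := by
        rw [hb₃, div_mul_eq_mul_div, div_eq_iff (by positivity)]
        ring
      rw [h4] at h3
      simpa using h3)
  have hsum : ∑ i, ∑ j, (b₃ + b₂ * (x i + x j) + b₁ * (x i * x j)) ≤ 1 / 2 := by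
    rw [sum_sum_add_mul_add_mul_mul, hxsum, Fintype.card_fin]
    have e1 : k ^ 2 * b₁ ≤ 1 / 8 := by
      have f1 : (16 : ℝ) * k ^ 2 ≤ S.card := by exact_mod_cast hS
      have f2 : (16 : ℝ) * k ^ 4 * K ≤ S.card ^ 2 := by exact_mod_cast hKS
      rw [hb₁, mul_div_assoc', div_le_iff₀ (by positivity)]
      nlinarith
    have e2 : 2 * q * k * b₂ ≤ 1 / 8 := by
      have f1 : (32 : ℝ) * q * k * (1 + D * q) ≤ n := by exact_mod_cast hDn
      rw [hb₂, mul_div_assoc', div_le_iff₀ hn0]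
      linarith
    have e3 : q ^ 2 * b₃ ≤ 1 / 4 := by
      have f1 : (32 : ℝ) * q ^ 2 ≤ n := by exact_mod_cast hqn
      have f2 : (32 : ℝ) * P.card * q ^ 4 ≤ n ^ 2 := by exact_mod_cast hPn
      rw [hb₃, mul_div_assoc', div_le_iff₀ (by positivity)]
      nlinarith
    linarith
  have hprod : ∏ l, ((X l).card : ℝ) = S.card ^ k * (n - S.card : ℝ) ^ (q - k) := by
    have : ∀ l, ((X l).card : ℝ) = if l ∈ I then (S.card : ℝ) else n - S.card := by
      intro l
      simp only [hX]
      split_ifs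
      · rfl
      · exact hScard
    simp only [this]
    rw [Finset.prod_ite, Finset.prod_const, Finset.prod_const, Finset.filter_mem_eq_inter,
      Finset.univ_inter, hI, ← Finset.compl_filter, Finset.filter_mem_eq_inter,
      Finset.univ_inter, Finset.card_compl, hI, Fintype.card_fin]
  have hcard : ((compatible P ∩ Fintype.piFinset X).card : ℝ) +
      (Fintype.piFinset X \ compatible P).card = ∏ l, ((X l).card : ℝ) := by
    have h1 := Finset.card_inter_add_card_sdiff (Fintype.piFinset X) (compatible P)
    rw [Finset.inter_comm] at h1
    have h2 := Fintype.card_piFinset X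
    rw [← h1] at h2
    exact_mod_cast h2
  rw [← hprod]
  have := mul_le_mul_of_nonneg_right hsum
    (Finset.prod_nonneg fun l _ => by positivity : (0 : ℝ) ≤ ∏ l, ((X l).card : ℝ))
  linarith

open scoped Classical in
-- The events that exactly the arguments in a `k`-set `I` go into `S` are disjoint. Each has at
-- least half of its functions compatible, and Bernoulli's inequality with `2 q s ≤ n` gives `(1 -
-- s/n)^(q-k) ≥ 1/2`; hence the constant `1/4`.
theorem choose_mul_le_card_compatible_filter {k D K : ℕ} (hk : 1 ≤ k) (S : Finset (Fin n))
    (hS : 16 * k ^ 2 ≤ S.card) (hKS : 16 * k ^ 4 * K ≤ S.card ^ 2) (hSn : 2 * q * S.card ≤ n)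
    (hkq : k ≤ q) (hDn : 32 * q * k * (1 + D * q) ≤ n) (hqn : 32 * q ^ 2 ≤ n)
    (hPn : 32 * P.card * q ^ 4 ≤ n ^ 2)
    (hdeg : ∀ v, (P.filter fun g => v ∈ Set.range g).card ≤ D)
    (hK : (P.filter fun g => 2 ≤ hits S g).card ≤ K) (hP : ∀ g ∈ P, hits S g ≤ k) :
    (q.choose k : ℝ) / 4 * (S.card / n) ^ k * (n : ℝ) ^ q ≤
      (((compatible P).filter fun f => k ≤ hits S f).card : ℝ) := by
  have hspos : 0 < S.card := lt_of_lt_of_le (by positivity) hS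
  have hSn2 : 2 * S.card ≤ n := le_trans (Nat.mul_le_mul_right _ (by omega)) hSn
  have hs0 : (0 : ℝ) < S.card := by exact_mod_cast hspos
  have hn0 : (0 : ℝ) < n := by exact_mod_cast (by omega : 0 < n)
  let Good : Finset (Fin q) → Finset (Fin q → Fin n) := fun I =>
    compatible P ∩ Fintype.piFinset fun i => if i ∈ I then S else Sᶜ
  have hGood : ∀ I f, f ∈ Good I → f ∈ compatible P ∧ ∀ i, f i ∈ S ↔ i ∈ I := by
    intro I f hf
    obtain ⟨h1, h2⟩ := Finset.mem_inter.1 hf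
    refine ⟨h1, fun i => ?_⟩
    have := Fintype.mem_piFinset.1 h2 i
    by_cases hi : i ∈ I
    · simpa [hi] using this
    · simpa [hi] using this
  have hsub : (Finset.powersetCard k Finset.univ).biUnion Good ⊆
      (compatible P).filter fun f => k ≤ hits S f := by
    intro f hf
    obtain ⟨I, hI, hfI⟩ := Finset.mem_biUnion.1 hf
    obtain ⟨h1, h2⟩ := hGood I f hfI
    refine Finset.mem_filter.2 ⟨h1, ?_⟩
    rw [← (Finset.mem_powersetCard.1 hI).2, hits]
    exact Finset.card_le_card fun i hi => by simp [(h2 i).2 hi]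
  have hdisj : ((Finset.powersetCard k (Finset.univ : Finset (Fin q)) :
      Set (Finset (Fin q)))).PairwiseDisjoint Good := by
    intro I _ J _ hIJ
    rw [Function.onFun, Finset.disjoint_left]
    intro f hI hJ
    exact hIJ (Finset.ext fun i => by rw [← (hGood I f hI).2 i, (hGood J f hJ).2 i])
  have h1 : (∑ I ∈ Finset.powersetCard k (Finset.univ : Finset (Fin q)), ((Good I).card : ℝ)) ≤
      (((compatible P).filter fun f => k ≤ hits S f).card : ℝ) := by
    have := Finset.card_le_card hsub
    rw [Finset.card_biUnion hdisj] at this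
    exact_mod_cast this
  refine le_trans ?_ h1
  have h2 : (q.choose k : ℝ) * ((S.card : ℝ) ^ k * (n - S.card : ℝ) ^ (q - k) / 2) ≤
      ∑ I ∈ Finset.powersetCard k (Finset.univ : Finset (Fin q)), ((Good I).card : ℝ) := by
    have := Finset.card_nsmul_le_sum (Finset.powersetCard k (Finset.univ : Finset (Fin q)))
      (fun I => ((Good I).card : ℝ)) _ fun I hI => half_le_card_compatible_inter_piFinset P hk S I
        (Finset.mem_powersetCard.1 hI).2 hS hKS hSn2 hDn hqn hPn hdeg hK hP
    rwa [Finset.card_powersetCard, Finset.card_univ, Fintype.card_fin, nsmul_eq_mul] at this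
  refine le_trans ?_ h2
  have h3 : (1 : ℝ) / 2 ≤ (1 - S.card / n) ^ (q - k) := by
    have hSn' : 2 * (q : ℝ) * S.card ≤ n := by exact_mod_cast hSn
    have hratio : (q : ℝ) * (S.card / n) ≤ 1 / 2 := by
      rw [mul_div_assoc', div_le_iff₀ hn0]
      linarith
    have hr0 : (0 : ℝ) ≤ S.card / n := by positivity
    have hr1 : (S.card : ℝ) / n ≤ 1 / 2 := by
      rw [div_le_iff₀ hn0]
      have : 2 * (S.card : ℝ) ≤ n := by exact_mod_cast hSn2
      linarith
    have hb := one_add_mul_le_pow (a := -((S.card : ℝ) / n)) (by linarith) (q - k)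
    have hqk : ((q - k : ℕ) : ℝ) ≤ q := by exact_mod_cast Nat.sub_le q k
    have := mul_le_mul_of_nonneg_right hqk hr0
    rw [← sub_eq_add_neg] at hb
    linarith
  have h4 : (n - S.card : ℝ) ^ (q - k) = (n : ℝ) ^ (q - k) * (1 - S.card / n) ^ (q - k) := by
    rw [← mul_pow]
    congr 1
    field_simp
  have h5 : (n : ℝ) ^ q = n ^ k * n ^ (q - k) := by
    rw [← pow_add]
    congr 1
    omega
  rw [h4, h5, div_pow]
  have h6 : (q.choose k : ℝ) / 4 * (S.card ^ k / n ^ k) * (n ^ k * n ^ (q - k)) =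
      q.choose k * (S.card ^ k * (n ^ (q - k) * (1 / 2)) / 2) := by
    field_simp
    ring
  rw [h6]
  gcongr

end Counting

/-! ### From linear families to clique systems -/

/-- The hypergraph on `Fin n` whose edges are the `k`-subsets of the ranges of the members
of `P`. -/
def rangeHypergraph {q n : ℕ} (k : ℕ) (P : Finset (Fin q → Fin n)) : Hypergraph (Fin n) where
  vertexSet := Set.univ
  edgeSet := {A | A.ncard = k ∧ ∃ Q ∈ Set.range '' (P : Set (Fin q → Fin n)), A ⊆ Q}
  subset_vertexSet_of_mem_edgeSet' := fun _ _ => Set.subset_univ _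

theorem IsLinearFamily.isCliqueSystem {q n k : ℕ} {P : Finset (Fin q → Fin n)}
    (hP : IsLinearFamily P) :
    IsCliqueSystem 1 q k (rangeHypergraph k P) (Set.range '' (P : Set (Fin q → Fin n))) where
  finite_vertexSet := Set.toFinite _
  subset_vertexSet := fun _ _ => Set.subset_univ _
  ncard_clique := by
    rintro _ ⟨g, hg, rfl⟩
    rw [← Set.image_univ, Set.ncard_image_of_injective _ (hP.1 g hg), Set.ncard_univ,
      Nat.card_eq_fintype_card, Fintype.card_fin]
  ncard_inter_le := by
    rintro _ ⟨g, hg, rfl⟩ _ ⟨h, hh, rfl⟩ hne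
    rw [Set.ncard_le_one]
    intro u hu v hv
    exact hP.2 g hg h hh (fun he => hne (by rw [he])) u hu v hv
  edgeSet_eq := rfl

/-- Different members have different ranges: equal ranges would share `q ≥ 2` points. -/
theorem IsLinearFamily.ncard_image_range {q n : ℕ} (hq : 2 ≤ q) {P : Finset (Fin q → Fin n)}
    (hP : IsLinearFamily P) : (Set.range '' (P : Set (Fin q → Fin n))).ncard = P.card := by
  refine Eq.trans (Set.InjOn.ncard_image fun g hg h hh he => ?_) (Set.ncard_coe_finset P)
  by_contra hne
  have hmem : ∀ i, g i ∈ Set.range g ∩ Set.range h := fun i => ⟨⟨i, rfl⟩, by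
    rw [← show Set.range g = Set.range h from he]; exact ⟨i, rfl⟩⟩
  have := hP.1 g hg (hP.2 g hg h hh hne _ (hmem ⟨0, by omega⟩) _ (hmem ⟨1, by omega⟩))
  simp at this

/-- If every `s`-set of vertices is hit `k` times by some member of `P`, colour classes have fewer
than `s` vertices. -/
theorem IsLinearFamily.le_cliqueF_mul {q n k s : ℕ} (hk : 2 ≤ k) (hkq : k ≤ q)
    {P : Finset (Fin q → Fin n)} (hP : IsLinearFamily P)
    (hS : ∀ S : Finset (Fin n), S.card = s → ∃ f ∈ P, k ≤ hits S f) :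
    n ≤ cliqueF 1 P.card q k * s := by
  set H := rangeHypergraph k P with hH
  have hsys : IsCliqueSystem 1 q k H _ := hP.isCliqueSystem
  have hχ : chromaticNum H ≤ cliqueF 1 P.card q k :=
    (cliqueF_isGreatest 1 P.card q k hk hkq).2
      ⟨Fin n, H, _, hsys, hP.ncard_image_range (by omega), rfl⟩
  have hprop : HasProperColoring H (chromaticNum H) :=
    Nat.sInf_mem (s := {r | HasProperColoring H r}) ⟨_, hsys.hasProperColoring hk⟩
  obtain ⟨c, hc, hcE⟩ := hprop
  refine le_trans ?_ (Nat.mul_le_mul_right s hχ)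
  by_contra! hlt
  obtain ⟨y, -, hy⟩ := Finset.exists_lt_card_fiber_of_mul_lt_card_of_maps_to
    (s := (Finset.univ : Finset (Fin n))) (t := Finset.range (chromaticNum H)) (f := c) (n := s)
    (fun x _ => Finset.mem_range.2 (hc x (Set.mem_univ x)))
    (by rwa [Finset.card_range, Finset.card_univ, Fintype.card_fin])
  obtain ⟨S, hSsub, hScard⟩ := Finset.exists_subset_card_eq hy.le
  obtain ⟨f, hfP, hf⟩ := hS S hScard
  obtain ⟨I, hIsub, hIcard⟩ := Finset.exists_subset_card_eq hf
  have hcol : ∀ i ∈ I, c (f i) = y := fun i hi => by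
    have h1 := (Finset.mem_filter.1 (hIsub hi)).2
    exact (Finset.mem_filter.1 (hSsub h1)).2
  obtain ⟨_, ⟨i, hi, rfl⟩, _, ⟨j, hj, rfl⟩, hij⟩ := hcE (f '' I) ⟨by
    rw [Set.ncard_image_of_injective _ (hP.1 f hfP), Set.ncard_coe_finset, hIcard],
    Set.range f, ⟨f, hfP, rfl⟩, Set.image_subset_range _ _⟩
  exact hij (by rw [hcol i hi, hcol j hj])

/-- The random greedy construction of a clique system without large independent sets. -/
theorem le_cliqueF_mul_of_bounds (k q n s T D K : ℕ) (hk : 2 ≤ k) (hkq : k ≤ q)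
    (hs : 16 * k ^ 2 ≤ s) (hKs : 16 * k ^ 4 * K ≤ s ^ 2) (hsn : 2 * q * s ≤ n)
    (hDn : 32 * q * k * (1 + D * q) ≤ n) (hqn : 32 * q ^ 2 ≤ n) (hTn : 32 * T * q ^ 4 ≤ n ^ 2)
    (hp : (q.choose k : ℝ) / 4 * (s / n : ℝ) ^ k ≤ 1)
    (hinit : (n : ℝ) * (1 + 2 * q / n) ^ T / 2 ^ D +
      n.choose s * (1 + 2 * (q * s / n : ℝ) ^ 2) ^ T / 2 ^ K +
      n.choose s * (1 - (q.choose k : ℝ) / 4 * (s / n : ℝ) ^ k) ^ T < 1) :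
    n ≤ cliqueF 1 T q k * s := by
  classical
  have hqpos : 0 < q := by omega
  have hnpos : 0 < n := lt_of_lt_of_le (by positivity) hqn
  have hn0 : (0 : ℝ) < n := by exact_mod_cast hnpos
  have : Nontrivial (Fin q) := Fin.nontrivial_iff_two_le.2 (by omega)
  -- The tests are the degree at `v`, the double hits of `S` and the `k`-fold hits of `S`. The first
  -- two rates are twice those among all functions, because compatible functions make up at least
  -- half.
  obtain ⟨P, hP, hPT, hkill⟩ := exists_greedy_family (α := Fin q → Fin n) IsLinearFamily compatible
    (Finset.univ : Finset (Fin n)) (Finset.powersetCard s (Finset.univ : Finset (Fin n)))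
    (fun v => Finset.univ.filter fun f => v ∈ Set.range f)
    (fun S => Finset.univ.filter fun f => 2 ≤ hits S f)
    (fun S => Finset.univ.filter fun f => k ≤ hits S f)
    (2 * q / n) (2 * (q * s / n : ℝ) ^ 2) ((q.choose k : ℝ) / 4 * (s / n : ℝ) ^ k) D K T
    (by positivity) (by positivity) hp ⟨by simp, by simp⟩
    (by simpa [Finset.card_powersetCard] using hinit)
    (fun P hP f hf => hP.insert hf) (by
      intro P hP hPT hdeg hcount
      have hPn : 32 * P.card * q ^ 4 ≤ n ^ 2 :=
        (Nat.mul_le_mul_right _ (Nat.mul_le_mul_left _ hPT.le)).trans hTn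
      have hhalf := half_le_card_compatible P (by omega) hnpos
        ((Nat.mul_le_mul_right _ (Nat.mul_le_mul_right _ (by omega))).trans hPn)
      have hnq : (0 : ℝ) < (n : ℝ) ^ q := by positivity
      have hdeg' : ∀ v, (P.filter fun g => v ∈ Set.range g).card ≤ D := fun v => by
        have := hdeg v (Finset.mem_univ v)
        rw [Finset.inter_filter, Finset.inter_univ] at this
        exact this.le
      refine ⟨?_, ?_, ?_, ?_⟩
      · rw [← Finset.card_pos]
        have : (0 : ℝ) < (compatible P).card := by linarith
        exact_mod_cast this
      · intro v _
        have h1 := card_filter_mem_range_le (q := q) (by omega) hnpos v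
        have h2 : ((compatible P ∩ Finset.univ.filter fun f => v ∈ Set.range f).card : ℝ) ≤
            ((Finset.univ : Finset (Fin q → Fin n)).filter fun f => v ∈ Set.range f).card := by
          exact_mod_cast Finset.card_le_card Finset.inter_subset_right
        have h3 : (q : ℝ) / n * (n : ℝ) ^ q ≤ 2 * q / n * (compatible P).card := by
          have : (0 : ℝ) ≤ q / n := by positivity
          calc (q : ℝ) / n * (n : ℝ) ^ q ≤ q / n * (2 * (compatible P).card) :=
                mul_le_mul_of_nonneg_left (by linarith) this
            _ = _ := by ring
        exact h2.trans (le_trans (by convert h1) h3)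
      · intro S hS
        have h1 := card_filter_two_le_hits_le (q := q) hnpos S
        rw [(Finset.mem_powersetCard.1 hS).2] at h1
        have h2 : ((compatible P ∩ Finset.univ.filter fun f => 2 ≤ hits S f).card : ℝ) ≤
            ((Finset.univ : Finset (Fin q → Fin n)).filter fun f => 2 ≤ hits S f).card := by
          exact_mod_cast Finset.card_le_card Finset.inter_subset_right
        refine h2.trans (h1.trans ?_)
        have : (0 : ℝ) ≤ (q * s / n : ℝ) ^ 2 := by positivity
        calc (q * s / n : ℝ) ^ 2 * (n : ℝ) ^ q ≤ (q * s / n : ℝ) ^ 2 * (2 * (compatible P).card) :=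
              mul_le_mul_of_nonneg_left (by linarith) this
          _ = _ := by ring
      · intro S hS hdis
        have hScard := (Finset.mem_powersetCard.1 hS).2
        have hK := (hcount S hS).le
        rw [Finset.inter_filter, Finset.inter_univ] at hK
        have hlow := choose_mul_le_card_compatible_filter P (k := k) (D := D) (K := K) (by omega) S
          (by rwa [hScard]) (by rwa [hScard]) (by rwa [hScard]) hkq hDn hqn hPn
          (by convert hdeg') hK (fun g hg => by
            by_contra! hlt
            exact Finset.disjoint_left.1 hdis hg (by simp [hlt.le]))
        rw [hScard] at hlow
        have hle : (q.choose k : ℝ) / 4 * (s / n : ℝ) ^ k * (compatible P).card ≤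
            (q.choose k : ℝ) / 4 * (s / n : ℝ) ^ k * (n : ℝ) ^ q :=
          mul_le_mul_of_nonneg_left (card_compatible_le P) (by positivity)
        refine (hle.trans hlow).trans (le_of_eq ?_)
        congr 2
        ext f
        simp)
  rw [← hPT]
  refine hP.le_cliqueF_mul hk hkq fun S hS => ?_
  obtain ⟨f, hfP, hf⟩ := Finset.not_disjoint_iff.1
    (hkill S (Finset.mem_powersetCard.2 ⟨Finset.subset_univ S, hS⟩))
  exact ⟨f, hfP, (Finset.mem_filter.1 hf).2⟩

/-! ### Numerical estimates for the greedy construction -/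

theorem pow_le_mul_choose {k q : ℕ} (hk : 1 ≤ k) (hkq : k ≤ q) :
    q ^ k ≤ k ^ k * k.factorial * q.choose k := by
  have h1 : q ≤ k * (q + 1 - k) := by
    obtain ⟨j, rfl⟩ := Nat.exists_eq_add_of_le hkq
    have : k + j + 1 - k = j + 1 := by omega
    rw [this]
    nlinarith
  calc q ^ k ≤ (k * (q + 1 - k)) ^ k := Nat.pow_le_pow_left h1 k
    _ = k ^ k * (q + 1 - k) ^ k := mul_pow _ _ _
    _ ≤ k ^ k * (k.factorial * q.choose k) := by
        rw [← Nat.descFactorial_eq_factorial_mul_choose]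
        exact Nat.mul_le_mul_left _ (Nat.pow_sub_le_descFactorial q k)
    _ = _ := by ring

theorem exp_neg_two_lt : Real.exp (-2) < 1 / 3 := by
  have h := Real.exp_one_gt_d9
  have h2 : Real.exp 2 = Real.exp 1 * Real.exp 1 := by
    rw [← Real.exp_add]; norm_num
  rw [Real.exp_neg, ← one_div]
  refine one_div_lt_one_div_of_lt (by norm_num) ?_
  rw [h2]
  nlinarith

/-- Uses `(1 + b)^T ≤ exp (b T)` and `2^D ≥ exp (D/2)`. The slack `2` leaves `exp (-2) < 1/3`, one
third of the budget for the three terms of the potential. -/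
theorem mul_one_add_pow_div_two_pow_lt {a α b : ℝ} {T D : ℕ} (ha : a ≤ Real.exp α) (hb : 0 ≤ b)
    (h : α + b * T + 2 ≤ D / 2) : a * (1 + b) ^ T / 2 ^ D < 1 / 3 := by
  have h1 : (1 + b) ^ T ≤ Real.exp (b * T) := by
    rw [mul_comm, Real.exp_nat_mul]
    exact pow_le_pow_left₀ (by linarith) (by linarith [Real.add_one_le_exp b]) T
  have h2 : Real.exp (D / 2) ≤ 2 ^ D := by
    rw [← Real.exp_log (by norm_num : (0 : ℝ) < 2), ← Real.exp_nat_mul,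
      Real.exp_log (by norm_num : (0 : ℝ) < 2)]
    refine Real.exp_le_exp.2 ?_
    have := Real.log_two_gt_d9
    nlinarith [(Nat.cast_nonneg D : (0 : ℝ) ≤ D)]
  rw [div_lt_iff₀ (by positivity)]
  calc a * (1 + b) ^ T ≤ Real.exp α * Real.exp (b * T) :=
        mul_le_mul ha h1 (by positivity) (Real.exp_pos _).le
    _ = Real.exp (α + b * T) := (Real.exp_add _ _).symm
    _ ≤ Real.exp (-2 + D / 2) := Real.exp_le_exp.2 (by linarith)
    _ = Real.exp (-2) * Real.exp (D / 2) := Real.exp_add _ _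
    _ < 1 / 3 * Real.exp (D / 2) := mul_lt_mul_of_pos_right exp_neg_two_lt (Real.exp_pos _)
    _ ≤ 1 / 3 * 2 ^ D := mul_le_mul_of_nonneg_left h2 (by norm_num)

theorem mul_one_sub_pow_lt {a α p : ℝ} {T : ℕ} (ha : a ≤ Real.exp α) (hp : p ≤ 1)
    (h : α + 2 ≤ p * T) : a * (1 - p) ^ T < 1 / 3 := by
  have h1 : (1 - p) ^ T ≤ Real.exp (-(p * T)) := by
    rw [neg_mul_eq_neg_mul, mul_comm, Real.exp_nat_mul]
    exact pow_le_pow_left₀ (by linarith) (Real.one_sub_le_exp_neg p) T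
  calc a * (1 - p) ^ T ≤ Real.exp α * Real.exp (-(p * T)) :=
        mul_le_mul ha h1 (pow_nonneg (by linarith) _) (Real.exp_pos _).le
    _ = Real.exp (α + -(p * T)) := (Real.exp_add _ _).symm
    _ ≤ Real.exp (-2) := Real.exp_le_exp.2 (by linarith)
    _ < 1 / 3 := exp_neg_two_lt

/-- This lets the exponent `p T` beat `s log n`, the logarithm of the bound `n^s` on the number of
`s`-sets. -/
theorem two_mul_le_choose_mul {k q n s T : ℕ} {ℓ : ℝ} (hk : 1 ≤ k) (hkq : k ≤ q)
    (hn0 : (0 : ℝ) < n)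
    (hT : 8 * (k ^ k * k.factorial : ℕ) * (n : ℝ) ^ k * ℓ ≤ q ^ k * (s : ℝ) ^ (k - 1) * T) :
    2 * s * ℓ ≤ (q.choose k : ℝ) / 4 * (s / n : ℝ) ^ k * T := by
  have hΓ : (q : ℝ) ^ k ≤ (k ^ k * k.factorial : ℕ) * q.choose k := by
    exact_mod_cast pow_le_mul_choose (by omega) hkq
  have hΓ0 : (0 : ℝ) < (k ^ k * k.factorial : ℕ) := by
    exact_mod_cast Nat.mul_pos (pow_pos (by omega) k) k.factorial_pos
  set Γ : ℝ := ((k ^ k * k.factorial : ℕ) : ℝ)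
  have hsk : (s : ℝ) ^ k = s * s ^ (k - 1) := by
    rw [← pow_succ']
    congr 1
    omega
  have h1 : 8 * Γ * (n : ℝ) ^ k * ℓ * s ≤ Γ * q.choose k * s ^ k * T := by
    calc 8 * Γ * (n : ℝ) ^ k * ℓ * s ≤ q ^ k * (s : ℝ) ^ (k - 1) * T * s :=
          mul_le_mul_of_nonneg_right hT (by positivity)
      _ = q ^ k * (s ^ k * T) := by rw [hsk]; ring
      _ ≤ Γ * q.choose k * (s ^ k * T) := mul_le_mul_of_nonneg_right hΓ (by positivity)
      _ = _ := by ring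
  have h2 : 8 * (n : ℝ) ^ k * ℓ * s ≤ q.choose k * s ^ k * T :=
    le_of_mul_le_mul_left (by linarith) hΓ0
  have h3 : (q.choose k : ℝ) / 4 * (s / n : ℝ) ^ k * T = q.choose k * s ^ k * T / (4 * n ^ k) := by
    rw [div_pow]
    field_simp
  rw [h3, le_div_iff₀ (by positivity)]
  linarith

theorem two_mul_sq_mul_le {k q n s y : ℝ} (hk : 0 < k) (hq : 1 ≤ q ^ 2) (hy : 0 ≤ y) (hn : 0 < n)
    (hyn : 1536 * k ^ 2 * q ^ 2 * y ≤ n) :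
    2 * (q * s / n) ^ 2 * y ^ 2 ≤ s ^ 2 / k ^ 4 / 1000 := by
  have h1 : (1536 * k ^ 2 * q ^ 2 * y) ^ 2 ≤ n ^ 2 := pow_le_pow_left₀ (by positivity) hyn 2
  have h2 : (q * s / n) ^ 2 * y ^ 2 * (1536 ^ 2 * k ^ 4) ≤ s ^ 2 := by
    rw [div_pow, div_mul_eq_mul_div, div_mul_eq_mul_div, div_le_iff₀ (by positivity)]
    have h3 : (q * s) ^ 2 * y ^ 2 * (1536 ^ 2 * k ^ 4) * 1 ≤
        (q * s) ^ 2 * y ^ 2 * (1536 ^ 2 * k ^ 4) * q ^ 2 :=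
      mul_le_mul_of_nonneg_left hq (by positivity)
    have h4 := mul_le_mul_of_nonneg_left h1 (by positivity : 0 ≤ s ^ 2)
    linarith
  have h3 : (q * s / n) ^ 2 * y ^ 2 * 1536 ^ 2 ≤ s ^ 2 / k ^ 4 := by
    rw [le_div_iff₀ (by positivity)]
    linarith
  have h4 : 0 ≤ (q * s / n) ^ 2 * y ^ 2 := by positivity
  linarith

/-- Here `y` stands for `√T`. With `n` at least of order `q² y`, the degree term is at most `y/2`,
so some `D` of order `y` suffices and `q² D` stays within `n`. -/
theorem exists_degree_bound {k q n y : ℝ} (hk : 1 ≤ k) (hq : 1 ≤ q) (hn : 0 < n)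
    (hlog : 0 ≤ Real.log n) (hy : 1 ≤ y) (hyn : 1536 * k ^ 2 * q ^ 2 * y ≤ n)
    (hL : Real.log n + 1 ≤ 4 * y) :
    ∃ D : ℕ, Real.log n + 2 * q / n * y ^ 2 + 2 ≤ D / 2 ∧ 32 * q * k * (1 + D * q) ≤ n := by
  have hkk : k ≤ k ^ 2 := by nlinarith
  have hqq : q ≤ q ^ 2 := by nlinarith
  have hqT : 2 * q / n * y ^ 2 ≤ y / 2 := by
    rw [div_mul_eq_mul_div, div_le_iff₀ hn]
    have h1 : 1536 * k ^ 2 * q ^ 2 * y * y ≤ n * y := mul_le_mul_of_nonneg_right hyn (by linarith)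
    have h2 : q * y ^ 2 ≤ q ^ 2 * y ^ 2 := mul_le_mul_of_nonneg_right hqq (by positivity)
    have h3 : 1 * (q ^ 2 * y ^ 2) ≤ k ^ 2 * (q ^ 2 * y ^ 2) :=
      mul_le_mul_of_nonneg_right (by linarith) (by positivity)
    have h4 : 0 ≤ q ^ 2 * y ^ 2 := by positivity
    linarith
  have h0 : 0 ≤ 2 * q / n * y ^ 2 := by positivity
  refine ⟨⌈2 * (Real.log n + 2 * q / n * y ^ 2 + 2)⌉₊, ?_, ?_⟩
  · have := Nat.le_ceil (2 * (Real.log n + 2 * q / n * y ^ 2 + 2))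
    linarith
  · have hD := (Nat.ceil_lt_add_one (by linarith :
      0 ≤ 2 * (Real.log n + 2 * q / n * y ^ 2 + 2))).le
    generalize (⌈2 * (Real.log n + 2 * q / n * y ^ 2 + 2)⌉₊ : ℝ) = D at hD
    have h1 : D + 1 ≤ 25 * y := by linarith
    have h2 : 1 + D * q ≤ 25 * y * q := by
      have := mul_le_mul_of_nonneg_right h1 (by linarith : 0 ≤ q)
      linarith
    calc 32 * q * k * (1 + D * q) ≤ 32 * q * k * (25 * y * q) :=
          mul_le_mul_of_nonneg_left h2 (by positivity)
      _ = k * (800 * (q ^ 2 * y)) := by ring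
      _ ≤ k ^ 2 * (800 * (q ^ 2 * y)) := mul_le_mul_of_nonneg_right hkk (by positivity)
      _ ≤ k ^ 2 * (1536 * (q ^ 2 * y)) :=
          mul_le_mul_of_nonneg_left (by nlinarith [(by positivity : 0 ≤ q ^ 2 * y)]) (by positivity)
      _ = 1536 * k ^ 2 * q ^ 2 * y := by ring
      _ ≤ n := hyn

theorem choose_div_four_mul_le_one {k q n s : ℕ} (hn0 : (0 : ℝ) < n) (hsn : (q : ℝ) * s ≤ n) :
    (q.choose k : ℝ) / 4 * (s / n : ℝ) ^ k ≤ 1 := by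
  have h1 : (q.choose k : ℝ) ≤ q ^ k := by exact_mod_cast Nat.choose_le_pow q k
  have h2 : (q * (s / n) : ℝ) ^ k ≤ 1 := by
    refine pow_le_one₀ (by positivity) ?_
    rwa [mul_div_assoc', div_le_one hn0]
  have h3 : (q.choose k : ℝ) * (s / n : ℝ) ^ k ≤ 1 := by
    refine le_trans (mul_le_mul_of_nonneg_right h1 (by positivity)) ?_
    rwa [← mul_pow]
  linarith

/-- `K` is the largest value allowed by `16 k^4 K ≤ s²`. It beats `s log n` because `s` is large
compared with `k^4 log n`, and beats the expected number of double hits because `n` is large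
compared with `q² y`. -/
theorem exists_count_bound {k s : ℕ} {q n y : ℝ} (hk : 0 < k) (hq : 1 ≤ q ^ 2) (hy : 0 ≤ y)
    (hn : 0 < n) (hlog : 0 ≤ Real.log n) (hs : 192 * (k : ℝ) ^ 4 * (Real.log n + 1) ≤ s)
    (hyn : 1536 * (k : ℝ) ^ 2 * q ^ 2 * y ≤ n) :
    ∃ K : ℕ, 16 * k ^ 4 * K ≤ s ^ 2 ∧
      s * Real.log n + 2 * (q * s / n) ^ 2 * y ^ 2 + 2 ≤ K / 2 := by
  have hk0 : (0 : ℝ) < k := by exact_mod_cast hk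
  have hk1 : (1 : ℝ) ≤ k := by exact_mod_cast hk
  have hk4 : (1 : ℝ) ≤ (k : ℝ) ^ 4 := one_le_pow₀ hk1
  have hs1 : (1 : ℝ) ≤ s := by nlinarith
  refine ⟨s ^ 2 / (16 * k ^ 4), Nat.mul_div_le _ _, ?_⟩
  set K := s ^ 2 / (16 * k ^ 4)
  have hK1 : (s : ℝ) ^ 2 / k ^ 4 / 16 ≤ K + 1 := by
    have hpos : 0 < 16 * k ^ 4 := by positivity
    have := (Nat.lt_mul_div_succ (s ^ 2) hpos).le
    rw [div_div, div_le_iff₀ (by positivity)]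
    have h2 : (s : ℝ) ^ 2 ≤ 16 * k ^ 4 * (K + 1) := by exact_mod_cast this
    linarith
  have e1 : 192 * (s * (Real.log n + 1)) ≤ (s : ℝ) ^ 2 / k ^ 4 := by
    rw [le_div_iff₀ (by positivity)]
    have := mul_le_mul_of_nonneg_left hs (by linarith : (0 : ℝ) ≤ s)
    linarith
  have e2 := two_mul_sq_mul_le (s := s) hk0 hq hy hn hyn
  have e3 : 0 ≤ s * Real.log n := by positivity
  linarith

theorem le_cliqueF_mul_of_log_bounds (k q n s T : ℕ) (y : ℝ) (hk : 3 ≤ k) (hkq : k ≤ q)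
    (hy : 1 ≤ y) (hyT : y ^ 2 = T) (hs : 192 * (k : ℝ) ^ 4 * (Real.log n + 1) ≤ s)
    (hsn : 2 * q * s ≤ n) (hyn : 1536 * (k : ℝ) ^ 2 * q ^ 2 * y ≤ n)
    (hL : Real.log n + 1 ≤ 4 * y)
    (hT : 8 * (k ^ k * k.factorial : ℕ) * (n : ℝ) ^ k * (Real.log n + 1) ≤
      q ^ k * (s : ℝ) ^ (k - 1) * T) :
    n ≤ cliqueF 1 T q k * s := by
  have hk3 : (3 : ℝ) ≤ k := by exact_mod_cast hk
  have hq3 : (3 : ℝ) ≤ q := by exact_mod_cast hk.trans hkq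
  have hkq' : (k : ℝ) ≤ q := by exact_mod_cast hkq
  have hk2 : (1 : ℝ) ≤ (k : ℝ) ^ 2 := one_le_pow₀ (by linarith)
  have hk4 : (1 : ℝ) ≤ (k : ℝ) ^ 4 := one_le_pow₀ (by linarith)
  have hq2 : (1 : ℝ) ≤ (q : ℝ) ^ 2 := one_le_pow₀ (by linarith)
  have hn1536 : 1536 * (q : ℝ) ^ 2 * y ≤ n := by
    have : 0 ≤ (q : ℝ) ^ 2 * y := by positivity
    nlinarith
  have hn1 : (1 : ℝ) ≤ n := by nlinarith
  have hn0 : (0 : ℝ) < n := by linarith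
  have hlog0 : 0 ≤ Real.log n := Real.log_nonneg hn1
  have hs192 : 192 * (k : ℝ) ^ 4 ≤ s := by nlinarith
  have hs1 : (1 : ℝ) ≤ s := by linarith
  have hsn' : 2 * (q : ℝ) * s ≤ n := by exact_mod_cast hsn
  have hchoose : (n.choose s : ℝ) ≤ Real.exp (s * Real.log n) := by
    rw [Real.exp_nat_mul, Real.exp_log hn0]
    exact_mod_cast Nat.choose_le_pow n s
  have hp1 : (q.choose k : ℝ) / 4 * (s / n : ℝ) ^ k ≤ 1 :=
    choose_div_four_mul_le_one hn0 (by linarith)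
  have hpT : 2 * s * (Real.log n + 1) ≤ (q.choose k : ℝ) / 4 * (s / n : ℝ) ^ k * T :=
    two_mul_le_choose_mul (by omega) hkq hn0 hT
  obtain ⟨D, hD, hDn⟩ := exists_degree_bound (by linarith) (by linarith) hn0 hlog0 hy hyn hL
  rw [hyT] at hD
  obtain ⟨K, hKs, hK⟩ := exists_count_bound (s := s) (by omega) hq2 (by linarith) hn0 hlog0 hs hyn
  rw [hyT] at hK
  refine le_cliqueF_mul_of_bounds k q n s T D K (by omega) hkq ?_ hKs hsn
    (by exact_mod_cast hDn) ?_ ?_ hp1 ?_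
  · have : 16 * (k : ℝ) ^ 2 ≤ s := by nlinarith
    exact_mod_cast this
  · have : 32 * (q : ℝ) ^ 2 ≤ n := by nlinarith
    exact_mod_cast this
  · have h1 : (1536 * (q : ℝ) ^ 2 * y) ^ 2 ≤ (n : ℝ) ^ 2 :=
      pow_le_pow_left₀ (by positivity) hn1536 2
    have h2 : 32 * (T : ℝ) * q ^ 4 ≤ n ^ 2 := by
      rw [← hyT]
      have : 0 ≤ y ^ 2 * (q : ℝ) ^ 4 := by positivity
      linarith
    exact_mod_cast h2
  · have t1 : (n : ℝ) * (1 + 2 * q / n) ^ T / 2 ^ D < 1 / 3 :=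
      mul_one_add_pow_div_two_pow_lt (α := Real.log n) (Real.exp_log hn0).ge (by positivity) hD
    have t2 : (n.choose s : ℝ) * (1 + 2 * (q * s / n : ℝ) ^ 2) ^ T / 2 ^ K < 1 / 3 :=
      mul_one_add_pow_div_two_pow_lt hchoose (by positivity) hK
    have t3 : (n.choose s : ℝ) * (1 - (q.choose k : ℝ) / 4 * (s / n : ℝ) ^ k) ^ T < 1 / 3 := by
      refine mul_one_sub_pow_lt hchoose hp1 (le_trans ?_ hpT)
      have : 0 ≤ s * Real.log n := by positivity
      linarith
    linarith

/-! ### Choice of `n` and `s` -/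

theorem one_le_mul_sq_mul_of_le {k : ℕ} {w q x : ℝ} (hk : 3 ≤ k) (hw : 1 ≤ w) (hq : 0 < q)
    (hx : 0 < x) (h : q * w ^ 4 ≤ x ^ (k - 1) * (w ^ 8 * q ^ k)) : 1 ≤ x * (w ^ 2 * q) := by
  have hqk : q ^ k = q ^ (k - 1) * q := by
    rw [← pow_succ]
    congr 1
    omega
  have h3 : w ^ 4 ≤ (w ^ 2) ^ (k - 1) := by
    rw [← pow_mul]
    exact pow_le_pow_right₀ hw (by omega)
  have h1 : 1 ≤ (x * (w ^ 2 * q)) ^ (k - 1) := by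
    refine le_of_mul_le_mul_left (a := q * w ^ 4) ?_ (by positivity)
    calc q * w ^ 4 * 1 ≤ x ^ (k - 1) * (w ^ 8 * q ^ k) := by linarith
      _ = q * w ^ 4 * (x ^ (k - 1) * (w ^ 4 * q ^ (k - 1))) := by rw [hqk]; ring
      _ ≤ q * w ^ 4 * (x ^ (k - 1) * ((w ^ 2) ^ (k - 1) * q ^ (k - 1))) := by gcongr
      _ = _ := by rw [← mul_pow, ← mul_pow]
  by_contra! hlt
  exact absurd h1 (not_le.2 (pow_lt_one₀ (by positivity) hlt (by omega)))

theorem four_mul_mul_le_one_of_le {k : ℕ} {w q x R : ℝ} (hk : 3 ≤ k) (hw : 1 ≤ w) (hq : 0 < q)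
    (hx : 0 < x) (hqw : q ≤ w) (h : x ^ (k - 1) * (w ^ 4 * q ^ (k - 2)) ≤ R)
    (hR : 4 ^ (k - 1) * R ≤ w ^ 2) : 4 * q * x ≤ 1 := by
  have hqk : q ^ (k - 1) = q ^ (k - 2) * q := by
    rw [← pow_succ]
    congr 1
    omega
  have hR0 : 0 ≤ R := le_trans (by positivity) h
  have h1 : (4 * q * x) ^ (k - 1) ≤ 1 := by
    refine le_of_mul_le_mul_right (a := w ^ 4 * q ^ (k - 2)) ?_ (by positivity)
    calc (4 * q * x) ^ (k - 1) * (w ^ 4 * q ^ (k - 2))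
        = 4 ^ (k - 1) * q ^ (k - 1) * (x ^ (k - 1) * (w ^ 4 * q ^ (k - 2))) := by
          rw [mul_pow, mul_pow]; ring
      _ ≤ 4 ^ (k - 1) * q ^ (k - 1) * R := by gcongr
      _ = q ^ (k - 2) * q * (4 ^ (k - 1) * R) := by rw [hqk]; ring
      _ ≤ q ^ (k - 2) * w * w ^ 2 := by gcongr
      _ = q ^ (k - 2) * (w ^ 3 * 1) := by ring
      _ ≤ q ^ (k - 2) * (w ^ 3 * w) := by gcongr
      _ = _ := by ring
  by_contra! hlt
  exact absurd h1 (not_le.2 (one_lt_pow₀ hlt (by omega)))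

theorem log_add_one_le {w q n N : ℝ} (hw : 1 ≤ w) (hq : 0 ≤ q) (hqw : q ≤ w) (hn : 0 < n)
    (hnN : n ≤ 2 * N * q ^ 2 * w ^ 4) (hN : 2 * N * Real.exp 1 ≤ w ^ 8) :
    Real.log n + 1 ≤ 2 * Real.log (w ^ 8) := by
  have h1 : n * Real.exp 1 ≤ w ^ 8 * w ^ 8 := by
    calc n * Real.exp 1 ≤ 2 * N * q ^ 2 * w ^ 4 * Real.exp 1 :=
          mul_le_mul_of_nonneg_right hnN (Real.exp_pos 1).le
      _ = 2 * N * Real.exp 1 * (q ^ 2 * w ^ 4) := by ring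
      _ ≤ w ^ 8 * (w ^ 2 * w ^ 4) := by gcongr
      _ = w ^ 8 * (w ^ 6 * 1) := by ring
      _ ≤ w ^ 8 * (w ^ 6 * w ^ 2) := by
          gcongr
          exact one_le_pow₀ hw
      _ = w ^ 8 * w ^ 8 := by ring
  have h2 := Real.log_le_log (by positivity) h1
  have hw8 : w ^ 8 ≠ 0 := by positivity
  rw [Real.log_mul hn.ne' (Real.exp_pos 1).ne', Real.log_exp, Real.log_mul hw8 hw8] at h2
  linarith

/-- Here `x` is essentially the density `s / n`. The eighth root `w` of `e` turns all size
comparisons into integer powers: `√e = w^4`, and the only use of `e` being large against `q` is `q ≤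
w`. -/
theorem exists_one_le_two_mul_cliqueF (k q e : ℕ) (w Γ : ℝ) (hk : 3 ≤ k) (hkq : k ≤ q)
    (hΓ : Γ = (k ^ k * k.factorial : ℕ)) (hw : 1 ≤ w) (hwe : w ^ 8 = e) (hqw : (q : ℝ) ≤ w)
    (hlog : (4 ^ (k - 1) * (32 * Γ * (1536 * k ^ 2)) + 384 * k ^ 4) * Real.log e ≤ w ^ 2)
    (hexp : 2 * (1536 * (k : ℝ) ^ 2) * Real.exp 1 ≤ e) :
    ∃ x : ℝ, 0 < x ∧
      x ^ (k - 1) * (w ^ 4 * (q : ℝ) ^ (k - 2)) ≤ 32 * Γ * (1536 * k ^ 2) * Real.log e ∧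
      1 ≤ 2 * x * cliqueF 1 e q k := by
  have hk3 : (3 : ℝ) ≤ k := by exact_mod_cast hk
  have hq3 : (3 : ℝ) ≤ q := by exact_mod_cast hk.trans hkq
  have hq0 : (0 : ℝ) < q := by linarith
  have hw0 : (0 : ℝ) < w := by linarith
  have hk2 : (1 : ℝ) ≤ (k : ℝ) ^ 2 := one_le_pow₀ (by linarith)
  have hq2 : (1 : ℝ) ≤ (q : ℝ) ^ 2 := one_le_pow₀ (by linarith)
  have hΓ1 : 1 ≤ Γ := by
    rw [hΓ]
    exact_mod_cast Nat.mul_pos (pow_pos (by omega) k) k.factorial_pos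
  have hy1 : 1 ≤ w ^ 4 := one_le_pow₀ hw
  have hye : (w ^ 4) ^ 2 = e := by rw [← hwe]; ring
  have he0 : (0 : ℝ) < e := by rw [← hwe]; positivity
  set N : ℝ := 1536 * (k : ℝ) ^ 2 with hN
  have hN1 : 1 ≤ N := by linarith
  -- An integer between `√e` and `2 √e`.
  set m := Nat.sqrt e + 1 with hm
  have hm1 : w ^ 4 ≤ m := by
    have h1 : e < m * m := Nat.lt_succ_sqrt e
    have h2 : (w ^ 4) ^ 2 < (m : ℝ) ^ 2 := by
      rw [hye, pow_two]
      exact_mod_cast h1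
    exact (lt_of_pow_lt_pow_left₀ 2 (by positivity) h2).le
  have hm2 : (m : ℝ) ≤ 2 * w ^ 4 := by
    have h1 : Nat.sqrt e * Nat.sqrt e ≤ e := Nat.sqrt_le e
    have h2 : (Nat.sqrt e : ℝ) ^ 2 ≤ (w ^ 4) ^ 2 := by
      rw [hye, pow_two]
      exact_mod_cast h1
    have h3 : (Nat.sqrt e : ℝ) ≤ w ^ 4 := le_of_sq_le_sq h2 (by positivity)
    rw [hm]
    push_cast
    linarith
  set n := 1536 * k ^ 2 * q ^ 2 * m with hn
  have hnN : (n : ℝ) = N * q ^ 2 * m := by rw [hn, hN]; push_cast; ring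
  have hn1 : N * q ^ 2 * w ^ 4 ≤ n := by
    rw [hnN]
    exact mul_le_mul_of_nonneg_left hm1 (by positivity)
  have hn2 : (n : ℝ) ≤ 2 * N * q ^ 2 * w ^ 4 := by
    rw [hnN]
    have := mul_le_mul_of_nonneg_left hm2 (by positivity : 0 ≤ N * (q : ℝ) ^ 2)
    linarith
  have hqw4 : q * w ^ 4 ≤ n := by
    refine le_trans ?_ hn1
    refine mul_le_mul_of_nonneg_right ?_ (by positivity)
    nlinarith
  have hn0 : (0 : ℝ) < n := lt_of_lt_of_le (by positivity) hqw4
  have hnone : (1 : ℝ) ≤ n := by nlinarith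
  set L := Real.log e with hL
  have hL1 : 1 ≤ L := by
    rw [hL, Real.le_log_iff_exp_le he0]
    refine le_trans ?_ hexp
    have := Real.exp_pos 1
    nlinarith
  have hL2 : L ≤ 2 * w ^ 4 := by
    rw [hL, ← hye, Real.log_pow]
    have := Real.log_le_self (by positivity : 0 ≤ w ^ 4)
    push_cast
    linarith
  have hℓ1 : 1 ≤ Real.log n + 1 := by linarith [Real.log_nonneg hnone]
  have hℓ2 : Real.log n + 1 ≤ 2 * L := by
    rw [hL, ← hwe]
    exact log_add_one_le hw hq0.le hqw hn0 hn2 (by rwa [hwe])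
  set ℓ := Real.log n + 1 with hℓ
  -- Chosen so that `s = n x` with `x^(k-1) = X` satisfies the requirement on `T = e` with equality.
  set X : ℝ := 8 * Γ * n * ℓ / (e * q ^ k) with hX
  have hX0 : 0 < X := by positivity
  have hXe : X * (e * q ^ k) = 8 * Γ * n * ℓ := div_mul_cancel₀ _ (by positivity)
  obtain ⟨x, hx0, hxX⟩ : ∃ x : ℝ, 0 < x ∧ x ^ (k - 1) = X :=
    ⟨X ^ (((k - 1 : ℕ) : ℝ)⁻¹), Real.rpow_pos_of_pos hX0 _,
      Real.rpow_inv_natCast_pow hX0.le (by omega)⟩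
  have hqk : (q : ℝ) ^ k = q ^ (k - 2) * q ^ 2 := by
    rw [← pow_add]
    congr 1
    omega
  have hbound : x ^ (k - 1) * (w ^ 4 * (q : ℝ) ^ (k - 2)) ≤ 32 * Γ * N * L := by
    refine le_of_mul_le_mul_right (a := w ^ 4 * (q : ℝ) ^ 2) ?_ (by positivity)
    calc x ^ (k - 1) * (w ^ 4 * (q : ℝ) ^ (k - 2)) * (w ^ 4 * (q : ℝ) ^ 2)
        = X * (e * q ^ k) := by rw [hxX, hqk, ← hwe]; ring
      _ = 8 * Γ * (n * ℓ) := by rw [hXe]; ring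
      _ ≤ 8 * Γ * (2 * N * q ^ 2 * w ^ 4 * (2 * L)) := by
          refine mul_le_mul_of_nonneg_left ?_ (by positivity)
          exact mul_le_mul hn2 hℓ2 (by positivity) (by positivity)
      _ = _ := by ring
  refine ⟨x, hx0, hbound, ?_⟩
  have hxlow : 1 ≤ x * (w ^ 2 * q) := by
    refine one_le_mul_sq_mul_of_le (k := k) hk hw hq0 hx0 ?_
    rw [hxX, hwe, hXe]
    have : 1 ≤ Γ * ℓ := one_le_mul_of_one_le_of_one_le hΓ1 hℓ1
    nlinarith
  have hxup : 4 * q * x ≤ 1 := by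
    refine four_mul_mul_le_one_of_le (k := k) hk hw hq0 hx0 hqw hbound (le_trans ?_ hlog)
    have : 0 ≤ 384 * (k : ℝ) ^ 4 * L := by positivity
    linarith
  have hnx : w ^ 2 ≤ n * x := by
    calc w ^ 2 = w ^ 2 * 1 := (mul_one _).symm
      _ ≤ w ^ 2 * (x * (w ^ 2 * q)) := by gcongr
      _ = q * w ^ 4 * x := by ring
      _ ≤ n * x := mul_le_mul_of_nonneg_right hqw4 hx0.le
  have hw2 : 1 ≤ w ^ 2 := one_le_pow₀ hw
  -- Since `n x ≥ w² ≥ 1`, rounding up at most doubles; this is the `2` in the conclusion.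
  set s := ⌈n * x⌉₊ with hs
  have hs1 : n * x ≤ s := Nat.le_ceil _
  have hs2 : (s : ℝ) ≤ 2 * (n * x) := by
    have := (Nat.ceil_lt_add_one (by positivity : 0 ≤ n * x)).le
    linarith
  have hmain := le_cliqueF_mul_of_log_bounds k q n s e (w ^ 4) hk hkq hy1 hye
    (by
      have h1 : 384 * (k : ℝ) ^ 4 * L ≤ w ^ 2 := by
        refine le_trans ?_ hlog
        have : 0 ≤ 4 ^ (k - 1) * (32 * Γ * N) * L := by positivity
        linarith
      have h2 := mul_le_mul_of_nonneg_left hℓ2 (by positivity : (0 : ℝ) ≤ 192 * (k : ℝ) ^ 4)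
      linarith)
    (by
      have h1 : 2 * (q : ℝ) * s ≤ n := by
        calc 2 * (q : ℝ) * s ≤ 2 * q * (2 * (n * x)) := by gcongr
          _ = n * (4 * q * x) := by ring
          _ ≤ n * 1 := by gcongr
          _ = n := mul_one _
      exact_mod_cast h1)
    hn1 (by linarith)
    (by
      rw [← hΓ]
      have h1 : (n * x) ^ (k - 1) ≤ (s : ℝ) ^ (k - 1) := pow_le_pow_left₀ (by positivity) hs1 _
      have hnk : (n : ℝ) ^ k = n ^ (k - 1) * n := by
        rw [← pow_succ]
        congr 1
        omega
      calc 8 * Γ * (n : ℝ) ^ k * ℓ = n ^ (k - 1) * (8 * Γ * n * ℓ) := by rw [hnk]; ring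
        _ = q ^ k * (n * x) ^ (k - 1) * e := by rw [← hXe, mul_pow, hxX]; ring
        _ ≤ _ := by gcongr)
  have hmain' : (n : ℝ) ≤ cliqueF 1 e q k * s := by exact_mod_cast hmain
  refine le_of_mul_le_mul_left (a := (n : ℝ)) ?_ hn0
  calc (n : ℝ) * 1 ≤ cliqueF 1 e q k * s := by linarith
    _ ≤ cliqueF 1 e q k * (2 * (n * x)) := by gcongr
    _ = _ := by ring

/-! ### The lower bound in terms of `e` and `q` -/

theorem one_le_cliqueF {k q e : ℕ} (hk : 2 ≤ k) (hkq : k ≤ q) (he : 1 ≤ e) :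
    1 ≤ cliqueF 1 e q k := by
  obtain ⟨V, H, 𝒬, h, hcard, hχ⟩ := (cliqueF_isGreatest 1 e q k hk hkq).1
  have hprop : HasProperColoring H (chromaticNum H) :=
    Nat.sInf_mem (s := {r | HasProperColoring H r}) ⟨_, h.hasProperColoring hk⟩
  obtain ⟨Q, hQ⟩ : 𝒬.Nonempty := Set.nonempty_of_ncard_ne_zero (by omega)
  obtain ⟨v, hv⟩ : Q.Nonempty := Set.nonempty_of_ncard_ne_zero (by
    rw [h.ncard_clique Q hQ]
    omega)
  obtain ⟨c, hc, -⟩ := hprop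
  have := hc v (h.subset_vertexSet Q hQ hv)
  omega

theorem cliqueF_lower_bound (k : ℕ) (hk : 3 ≤ k) : ∃ c : ℝ, 0 < c ∧ ∃ a : ℝ, 0 ≤ a ∧
    ∀ q e : ℕ, k ≤ q → q ^ (2 * k + 2) < e →
      c * (e : ℝ) ^ (1 / (2 * (k : ℝ) - 2)) * (q : ℝ) ^ (1 - 2 / ((k : ℝ) - 1))
        / Real.log (e : ℝ) ^ a < (cliqueF 1 e q k : ℝ) := by
  have hk3 : (3 : ℝ) ≤ k := by exact_mod_cast hk
  have hk1 : ((k - 1 : ℕ) : ℝ) = k - 1 := by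
    rw [Nat.cast_sub (by omega)]; simp
  set Γ : ℝ := ((k ^ k * k.factorial : ℕ) : ℝ) with hΓ
  have hΓ1 : 1 ≤ Γ := by
    rw [hΓ]
    exact_mod_cast Nat.mul_pos (pow_pos (by omega) k) k.factorial_pos
  set M : ℝ := 32 * Γ * (1536 * k ^ 2) with hM
  have hM1 : 1 ≤ M := by
    have : (1 : ℝ) ≤ (k : ℝ) ^ 2 := one_le_pow₀ (by linarith)
    have : 1 ≤ Γ * (k : ℝ) ^ 2 := one_le_mul_of_one_le_of_one_le hΓ1 this
    rw [hM]
    linarith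
  have hB : 0 < 4 ^ (k - 1) * M + 384 * (k : ℝ) ^ 4 := by positivity
  obtain ⟨E₀, hE₀⟩ : ∃ E₀ : ℕ, ∀ e : ℕ, E₀ ≤ e →
      (4 ^ (k - 1) * M + 384 * (k : ℝ) ^ 4) * Real.log e ≤ (e : ℝ) ^ (1 / 4 : ℝ) ∧
        2 * (1536 * (k : ℝ) ^ 2) * Real.exp 1 ≤ e := by
    have h1 := (isLittleO_log_rpow_atTop (r := 1 / 4) (by norm_num)).bound (inv_pos.2 hB)
    have h2 := h1.and (Filter.eventually_ge_atTop (2 * (1536 * (k : ℝ) ^ 2) * Real.exp 1))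
    obtain ⟨E₀, hE₀⟩ := Filter.eventually_atTop.1 (tendsto_natCast_atTop_atTop.eventually h2)
    refine ⟨E₀, fun e he => ⟨?_, (hE₀ e he).2⟩⟩
    have h3 := (hE₀ e he).1
    rw [Real.norm_of_nonneg (Real.rpow_nonneg (Nat.cast_nonneg e) _)] at h3
    have h4 := (le_abs_self _).trans h3
    rw [inv_mul_eq_div, le_div_iff₀ hB] at h4
    linarith
  -- The first entry serves `e ≥ E₀`. The second makes the claimed bound less than `1` for the
  -- finitely many smaller `e`, where `1 ≤ cliqueF` is enough.
  set c : ℝ := min (1 / (4 * M)) (1 / (2 * ((E₀ : ℝ) + 1) ^ 2)) with hc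
  have hc0 : 0 < c := by positivity
  refine ⟨c, hc0, 1 / ((k : ℝ) - 1), div_nonneg zero_le_one (by linarith), fun q e hkq hqe => ?_⟩
  have hq3 : (3 : ℝ) ≤ q := by exact_mod_cast hk.trans hkq
  have hq0 : (0 : ℝ) < q := by linarith
  have hq8 : (q : ℝ) ^ 8 ≤ e := by
    have : q ^ 8 ≤ e := (Nat.pow_le_pow_right (by omega) (by omega)).trans hqe.le
    exact_mod_cast this
  have he3 : (3 : ℝ) ≤ e := by
    refine le_trans ?_ hq8
    calc (3 : ℝ) ≤ q ^ 1 := by linarith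
      _ ≤ q ^ 8 := pow_le_pow_right₀ (by linarith) (by norm_num)
  have he0 : (0 : ℝ) < e := by linarith
  have hL1 : 1 ≤ Real.log e := by
    rw [Real.le_log_iff_exp_le he0]
    linarith [Real.exp_one_lt_d9]
  set L := Real.log e with hL
  set Z₁ : ℝ := (e : ℝ) ^ (1 / (2 * (k : ℝ) - 2)) with hZ₁
  set Z₂ : ℝ := (q : ℝ) ^ (1 - 2 / ((k : ℝ) - 1)) with hZ₂
  set Z₃ : ℝ := L ^ (1 / ((k : ℝ) - 1)) with hZ₃
  have hZ₁0 : 0 < Z₁ := Real.rpow_pos_of_pos he0 _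
  have hZ₂0 : 0 < Z₂ := Real.rpow_pos_of_pos hq0 _
  have hZ₃0 : 0 < Z₃ := Real.rpow_pos_of_pos (by linarith) _
  by_cases hlarge : E₀ ≤ e
  · obtain ⟨hlog, hexp⟩ := hE₀ e hlarge
    set w : ℝ := (e : ℝ) ^ (1 / 8 : ℝ) with hw
    have hwpow : ∀ j : ℕ, w ^ j = (e : ℝ) ^ ((j : ℝ) / 8) := fun j => by
      rw [hw, ← Real.rpow_natCast, ← Real.rpow_mul he0.le]
      congr 1
      ring
    have hw8 : w ^ 8 = e := by
      rw [hwpow]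
      norm_num
    have hw1 : 1 ≤ w := Real.one_le_rpow (by linarith) (by norm_num)
    have hqw : (q : ℝ) ≤ w := by
      rw [← hw8] at hq8
      exact le_of_pow_le_pow_left₀ (by norm_num) (by positivity) hq8
    obtain ⟨x, hx0, hx, hχ⟩ := exists_one_le_two_mul_cliqueF k q e w Γ hk hkq hΓ hw1 hw8 hqw
      (by
        rw [hwpow 2]
        refine hlog.trans (le_of_eq ?_)
        congr 1
        norm_num) hexp
    have hZ₁k : Z₁ ^ (k - 1) = w ^ 4 := by
      rw [hwpow, hZ₁, ← Real.rpow_natCast, ← Real.rpow_mul he0.le, hk1]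
      congr 1
      have : (k : ℝ) - 1 ≠ 0 := by linarith
      have : 2 * (k : ℝ) - 2 ≠ 0 := by linarith
      field_simp
      push_cast
      ring
    have hZ₂k : Z₂ ^ (k - 1) * q = (q : ℝ) ^ (k - 2) := by
      have h1 : Z₂ ^ (k - 1) = (q : ℝ) ^ ((k : ℝ) - 3) := by
        rw [hZ₂, ← Real.rpow_natCast, ← Real.rpow_mul hq0.le, hk1]
        congr 1
        have : (k : ℝ) - 1 ≠ 0 := by linarith
        field_simp
        ring
      rw [h1, ← Real.rpow_add_one hq0.ne', ← Real.rpow_natCast, Nat.cast_sub (by omega)]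
      congr 1
      push_cast
      ring
    have hZ₃k : Z₃ ^ (k - 1) = L := by
      rw [hZ₃, one_div, ← hk1]
      exact Real.rpow_inv_natCast_pow (by linarith) (by omega)
    have hxZ : x * (Z₁ * Z₂) ≤ M * Z₃ := by
      refine le_of_pow_le_pow_left₀ (n := k - 1) (by omega) (by positivity) ?_
      rw [mul_pow, mul_pow, mul_pow, hZ₁k, hZ₃k]
      -- A factor `q` is given away here: the construction yields `q^(1 - 1/(k-1))`, more than the
      -- exponent claimed.
      calc x ^ (k - 1) * (w ^ 4 * Z₂ ^ (k - 1)) ≤ x ^ (k - 1) * (w ^ 4 * (Z₂ ^ (k - 1) * q)) := by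
            gcongr
            exact le_mul_of_one_le_right (by positivity) (by linarith)
        _ ≤ M * L := by rw [hZ₂k]; exact hx
        _ ≤ M ^ (k - 1) * L := by
            gcongr
            exact le_self_pow₀ hM1 (by omega)
    rw [div_lt_iff₀ hZ₃0]
    refine lt_of_mul_lt_mul_left (a := x) ?_ hx0.le
    have hcM : c * M ≤ 1 / 4 := by
      have : c ≤ 1 / (4 * M) := min_le_left _ _
      rw [le_div_iff₀ (by positivity)] at this
      linarith
    calc x * (c * Z₁ * Z₂) = c * (x * (Z₁ * Z₂)) := by ring
      _ ≤ c * (M * Z₃) := by gcongr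
      _ = c * M * Z₃ := by ring
      _ ≤ 1 / 4 * Z₃ := by gcongr
      _ < 1 / 2 * Z₃ := by linarith
      _ ≤ x * cliqueF 1 e q k * Z₃ := by
          refine mul_le_mul_of_nonneg_right ?_ hZ₃0.le
          linarith
      _ = _ := by ring
  · have heE : (e : ℝ) ≤ E₀ + 1 := by
      have : e ≤ E₀ + 1 := by omega
      exact_mod_cast this
    have h1 : Z₁ ≤ E₀ + 1 := by
      calc Z₁ ≤ (e : ℝ) ^ (1 : ℝ) := Real.rpow_le_rpow_of_exponent_le (by linarith) (by
            rw [div_le_one (by linarith)]; linarith)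
        _ ≤ E₀ + 1 := by rwa [Real.rpow_one]
    have h2 : Z₂ ≤ E₀ + 1 := by
      calc Z₂ ≤ (q : ℝ) ^ ((8 : ℕ) : ℝ) := Real.rpow_le_rpow_of_exponent_le (by linarith) (by
            have : 0 ≤ 2 / ((k : ℝ) - 1) := div_nonneg zero_le_two (by linarith)
            push_cast
            linarith)
        _ ≤ E₀ + 1 := by
            rw [Real.rpow_natCast]
            linarith
    have h3 : 1 ≤ Z₃ := Real.one_le_rpow hL1 (div_nonneg zero_le_one (by linarith))
    have h4 : c * ((E₀ : ℝ) + 1) ^ 2 ≤ 1 / 2 := by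
      have : c ≤ 1 / (2 * ((E₀ : ℝ) + 1) ^ 2) := min_le_right _ _
      rw [le_div_iff₀ (by positivity)] at this
      linarith
    have h5 : (1 : ℝ) ≤ cliqueF 1 e q k := by
      have : 1 ≤ e := by exact_mod_cast (by linarith : (1 : ℝ) ≤ e)
      exact_mod_cast one_le_cliqueF (by omega) hkq this
    calc c * Z₁ * Z₂ / Z₃ ≤ c * Z₁ * Z₂ := div_le_self (by positivity) h3
      _ ≤ c * ((E₀ : ℝ) + 1) * ((E₀ : ℝ) + 1) := by gcongr
      _ = c * ((E₀ : ℝ) + 1) ^ 2 := by ring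
      _ < 1 := by linarith
      _ ≤ _ := h5

/-- Polylogarithmic factors are absorbed by `q ^ o(1)` when `log (M q) = q ^ o(1)`. -/
theorem exists_tendsto_zero_rpow_le {c a : ℝ} (hc : 0 < c) (ha : 0 ≤ a) (M : ℕ → ℝ)
    (hM : ∀ δ : ℝ, 0 < δ → ∀ᶠ q : ℕ in Filter.atTop, Real.log (M q) ≤ (q : ℝ) ^ δ) :
    ∃ o : ℕ → ℝ, Filter.Tendsto o Filter.atTop (nhds 0) ∧
      ∀ q : ℕ, 2 ≤ q → ∀ L : ℝ, 0 < L → L ≤ Real.log (M q) → (q : ℝ) ^ o q ≤ c / L ^ a := by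
  -- Solves `q ^ o q = c / (max 1 (log (M q)))^a`. The maximum with `1` keeps the outer logarithm
  -- nonnegative.
  refine ⟨fun q => (Real.log c - a * Real.log (max 1 (Real.log (M q)))) / Real.log q, ?_, ?_⟩
  · have hlogq : Filter.Tendsto (fun q : ℕ => Real.log q) Filter.atTop Filter.atTop :=
      Real.tendsto_log_atTop.comp tendsto_natCast_atTop_atTop
    have h1 : Filter.Tendsto (fun q : ℕ => Real.log c / Real.log q) Filter.atTop (nhds 0) :=
      hlogq.const_div_atTop _
    have h2 : Filter.Tendsto (fun q : ℕ => Real.log (max 1 (Real.log (M q))) / Real.log q)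
        Filter.atTop (nhds 0) := by
      rw [Metric.tendsto_nhds]
      intro ε hε
      filter_upwards [hM (ε / 2) (by linarith), Filter.eventually_ge_atTop 2] with q hq hq2
      have hq1 : (1 : ℝ) < q := by exact_mod_cast hq2
      have hlq : 0 < Real.log q := Real.log_pos hq1
      have hmax : max 1 (Real.log (M q)) ≤ (q : ℝ) ^ (ε / 2) :=
        max_le (Real.one_le_rpow hq1.le (by linarith)) hq
      have hlog := Real.log_le_log (by positivity) hmax
      rw [Real.log_rpow (by linarith)] at hlog
      have h0 : 0 ≤ Real.log (max 1 (Real.log (M q))) := Real.log_nonneg (le_max_left _ _)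
      rw [Real.dist_eq, sub_zero, abs_of_nonneg (by positivity)]
      have : Real.log (max 1 (Real.log (M q))) / Real.log q ≤ ε / 2 := by
        rwa [div_le_iff₀ hlq]
      linarith
    have h3 := h1.sub (h2.const_mul a)
    rw [mul_zero, sub_zero] at h3
    refine h3.congr fun q => ?_
    ring
  · intro q hq L hL hLM
    have hq1 : (1 : ℝ) < q := by exact_mod_cast hq
    have hlq : 0 < Real.log q := Real.log_pos hq1
    have hmax : (0 : ℝ) < max 1 (Real.log (M q)) := by positivity
    have heq : (q : ℝ) ^ ((Real.log c - a * Real.log (max 1 (Real.log (M q)))) / Real.log q) =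
        c / (max 1 (Real.log (M q))) ^ a := by
      rw [Real.rpow_def_of_pos (by linarith), mul_div_cancel₀ _ hlq.ne', Real.exp_sub,
        Real.exp_log hc, Real.rpow_def_of_pos hmax, mul_comm a]
    rw [heq]
    refine div_le_div_of_nonneg_left hc.le (Real.rpow_pos_of_pos hL a) ?_
    exact Real.rpow_le_rpow hL.le (hLM.trans (le_max_right _ _)) ha

theorem theorem2 (k : ℕ) (hk : 3 ≤ k) :
    -- upper bound, for all `e`
    (∃ C : ℝ, ∀ q e : ℕ, k ≤ q → 1 ≤ e →
      (cliqueF 1 e q k : ℝ) < C * (e : ℝ) ^ (1 / (2 * (k : ℝ) - 2)) * (q : ℝ)) ∧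
    -- lower bound up to a factor polylogarithmic in `e`, for all `e > q ^ (2 * k + 2)`
    (∃ c : ℝ, 0 < c ∧ ∃ a : ℝ, ∀ q e : ℕ, k ≤ q → q ^ (2 * k + 2) < e →
      c * (e : ℝ) ^ (1 / (2 * (k : ℝ) - 2)) * (q : ℝ) ^ (1 - 2 / ((k : ℝ) - 1))
        / Real.log (e : ℝ) ^ a < (cliqueF 1 e q k : ℝ)) ∧
    -- lower bound with `q ^ o(1)` as `q → ∞`, uniformly in the `e > q ^ (2 * k + 2)` that are at
    -- most `M q`, where `log (M q) ≤ q ^ o(1)`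
    (∀ M : ℕ → ℝ,
      (∀ δ : ℝ, 0 < δ → ∀ᶠ q : ℕ in Filter.atTop, Real.log (M q) ≤ (q : ℝ) ^ δ) →
      ∃ o : ℕ → ℝ, Filter.Tendsto o Filter.atTop (nhds 0) ∧
        ∀ q e : ℕ, k ≤ q → q ^ (2 * k + 2) < e → (e : ℝ) ≤ M q →
          (e : ℝ) ^ (1 / (2 * (k : ℝ) - 2)) * (q : ℝ) ^ (1 - 2 / ((k : ℝ) - 1) + o q)
            < (cliqueF 1 e q k : ℝ)) := by
  refine ⟨cliqueF_upper_bound k hk, ?_⟩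
  obtain ⟨c, hc, a, ha, hlow⟩ := cliqueF_lower_bound k hk
  refine ⟨⟨c, hc, a, hlow⟩, fun M hM => ?_⟩
  obtain ⟨o, ho, hoq⟩ := exists_tendsto_zero_rpow_le hc ha M hM
  refine ⟨o, ho, fun q e hkq hqe heM => lt_of_le_of_lt ?_ (hlow q e hkq hqe)⟩
  have hq0 : (0 : ℝ) < q := by exact_mod_cast (by omega : 0 < q)
  have he1 : 1 < e := lt_of_le_of_lt (Nat.one_le_pow _ _ (by omega)) hqe
  have he1' : (1 : ℝ) < e := by exact_mod_cast he1
  have h := hoq q (by omega) (Real.log e) (Real.log_pos he1')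
    (Real.log_le_log (by linarith) heM)
  rw [Real.rpow_add hq0, ← mul_assoc]
  calc _ ≤ (e : ℝ) ^ (1 / (2 * (k : ℝ) - 2)) * (q : ℝ) ^ (1 - 2 / ((k : ℝ) - 1)) *
        (c / Real.log e ^ a) := mul_le_mul_of_nonneg_left h (by positivity)
    _ = _ := by ring
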